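/- Let $n\ge 0$ and let $F_n$ be the free group of rank $n$. A simplicial tree is a tree regarded as a graph all of whose edges have length one, and actions on it are by graph automorphisms. An action is free if no nontrivial element fixes a point of the tree (that is, it fixes no vertex and maps no edge to itself), and minimal if there is no proper non-empty invariant subtree. The translation length of a conjugacy class $c$ of $F_n$ for an action on $T$ is $\ell_T(c)=\min_x d_T(x,gx)$, where $g\in c$ and $x$ runs over the vertices of $T$; it does not depend on the choice of $g$. Let $F_n$ act freely and minimally on a simplicial tree $T$. (1) There is a finite set $C$ of conjugacy classes of $F_n$ (depending on the action) which determines the action: if $F_n$ acts freely and minimally on a simplicial tree $T'$ and $\ell_{T'}(c)=\ell_T(c)$ for all $c\in C$, then there is an $F_n$-equivariant simplicial isomorphism $T\to T'$. (2) If the quotient graph $T/F_n$ is a rose (one vertex and $n$ edges), then there are exactly $2n^2+2n$ nontrivial conjugacy classes $c$ of $F_n$ with $\ell_T(c)\le 2$, and the set $C$ of these classes determines the action in the sense of (1). -/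

import Mathlib

/-!
An action of a group `Γ` on a simplicial tree is a homomorphism `ρ : Γ →* (T ≃g T)` into the
automorphism group of a graph `T : SimpleGraph V` with `T.IsTree`.  Every edge has length one.
-/

universe u v w

namespace TreeAction

section

variable {Γ : Type w} [Group Γ] {V : Type u} {T : SimpleGraph V}

/-- The action on the tree is free: a nontrivial element fixes no point of the geometric
realization, i.e. it fixes no vertex and maps no edge to itself (in particular it does not
interchange the two ends of an edge). -/
def IsFree (ρ : Γ →* (T ≃g T)) : Prop :=
  ∀ g : Γ, g ≠ 1 → (∀ x : V, ρ g x ≠ x) ∧ ∀ e ∈ T.edgeSet, Sym2.map (ρ g) e ≠ e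

/-- The action is minimal: there is no proper invariant subtree.  (A subtree of a tree is the
subgraph induced on a set of vertices for which that subgraph is connected; connected graphs are
non-empty.) -/
def IsMinimal (ρ : Γ →* (T ≃g T)) : Prop :=
  ∀ S : Set V, (T.induce S).Connected → (∀ g : Γ, ∀ x ∈ S, ρ g x ∈ S) → S = Set.univ

/-- The translation length of a group element: the least distance by which it moves a vertex. -/
noncomputable def elementLength (ρ : Γ →* (T ≃g T)) (g : Γ) : ℕ :=
  ⨅ x : V, T.dist x (ρ g x)

theorem dist_iso (φ : T ≃g T) (x y : V) : T.dist (φ x) (φ y) = T.dist x y := by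
  have key : ∀ (ψ : T ≃g T) (a b : V), T.Reachable a b → T.dist (ψ a) (ψ b) ≤ T.dist a b := by
    intro ψ a b h
    obtain ⟨p, hp⟩ := h.exists_walk_length_eq_dist
    rw [← hp, ← SimpleGraph.Walk.length_map ψ.toHom p]
    exact SimpleGraph.dist_le (p.map ψ.toHom)
  by_cases h : T.Reachable x y
  · refine le_antisymm (key φ x y h) ?_
    have h2 := key φ.symm (φ x) (φ y) (h.map φ.toHom)
    simpa using h2
  · have h2 : ¬ T.Reachable (φ x) (φ y) := by
      intro h3
      apply h
      simpa using h3.map φ.symm.toHom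
    rw [SimpleGraph.dist_eq_zero_of_not_reachable h, SimpleGraph.dist_eq_zero_of_not_reachable h2]

theorem elementLength_conj (ρ : Γ →* (T ≃g T)) (g h : Γ) :
    elementLength ρ (h * g * h⁻¹) = elementLength ρ g := by
  unfold elementLength
  refine (Function.Surjective.iInf_congr (ρ h) (ρ h).surjective ?_).symm
  intro x
  have e : ρ (h * g * h⁻¹) (ρ h x) = ρ h (ρ g x) := by
    rw [← RelIso.mul_apply, ← map_mul]
    simp
  rw [e, dist_iso]

/-- The translation length of a conjugacy class. -/
noncomputable def translationLength (ρ : Γ →* (T ≃g T)) (c : ConjClasses Γ) : ℕ :=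
  Quotient.lift (s := IsConj.setoid Γ) (elementLength ρ) (by
    intro a b hab
    obtain ⟨h, hh⟩ := isConj_iff.mp hab
    rw [← hh, elementLength_conj]) c

/-- An equivariant simplicial isomorphism between two trees with an action of `Γ`. -/
def EquivariantlyIsomorphic {V' : Type v} {T' : SimpleGraph V'}
    (ρ : Γ →* (T ≃g T)) (ρ' : Γ →* (T' ≃g T')) : Prop :=
  ∃ φ : T ≃g T', ∀ (g : Γ) (x : V), φ (ρ g x) = ρ' g (φ x)

/-- Among all free minimal actions of `Γ` on simplicial trees, the action `ρ` is determined, up to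
equivariant isomorphism, by the translation lengths of the conjugacy classes in `C`. -/
def IsDeterminedBy (ρ : Γ →* (T ≃g T)) (C : Set (ConjClasses Γ)) : Prop :=
  ∀ (V' : Type v) (T' : SimpleGraph V') (ρ' : Γ →* (T' ≃g T')),
    T'.IsTree → IsFree ρ' → IsMinimal ρ' →
    (∀ c ∈ C, translationLength ρ' c = translationLength ρ c) →
    EquivariantlyIsomorphic ρ ρ'

/-- Two vertices are equivalent if they lie in the same orbit. -/
def vertexSetoid (ρ : Γ →* (T ≃g T)) : Setoid V where
  r x y := ∃ g : Γ, ρ g x = y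
  iseqv :=
    { refl := fun x => ⟨1, by simp⟩
      symm := by
        rintro x y ⟨g, rfl⟩
        exact ⟨g⁻¹, by rw [← RelIso.mul_apply, ← map_mul]; simp⟩
      trans := by
        rintro x y z ⟨g, rfl⟩ ⟨h, rfl⟩
        exact ⟨h * g, by rw [map_mul, RelIso.mul_apply]⟩ }

/-- Two edges are equivalent if they lie in the same orbit. -/
def edgeSetoid (ρ : Γ →* (T ≃g T)) : Setoid T.edgeSet where
  r e f := ∃ g : Γ, Sym2.map (ρ g) e.1 = f.1
  iseqv :=
    { refl := by
        rintro ⟨e, he⟩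
        refine ⟨1, ?_⟩
        induction e with | _ x y => simp
      symm := by
        rintro ⟨e, he⟩ ⟨f, hf⟩ ⟨g, hg⟩
        refine ⟨g⁻¹, ?_⟩
        dsimp only at hg ⊢
        subst hg
        induction e with | _ x y =>
          simp only [Sym2.map_mk, ← RelIso.mul_apply, ← map_mul]
          simp
      trans := by
        rintro ⟨e, he⟩ ⟨f, hf⟩ ⟨d, hd⟩ ⟨g, hg⟩ ⟨h, hh⟩
        refine ⟨h * g, ?_⟩
        dsimp only at hg hh ⊢
        subst hg
        subst hh
        induction e with | _ x y => simp }

/-- The quotient of the tree by the action, as a graph (loops and multiple edges allowed): its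
vertices are the orbits of vertices, its edges the orbits of edges. -/
def quotientGraph (ρ : Γ →* (T ≃g T)) :
    Graph (Quotient (vertexSetoid ρ)) (Quotient (edgeSetoid ρ)) where
  vertexSet := Set.univ
  IsLink q a b := ∃ (x y : V) (h : T.Adj x y),
    q = Quotient.mk (edgeSetoid ρ) ⟨s(x, y), h⟩ ∧
    a = Quotient.mk (vertexSetoid ρ) x ∧ b = Quotient.mk (vertexSetoid ρ) y
  isLink_symm := by
    intro q _
    refine ⟨?_⟩
    rintro a b ⟨x, y, h, rfl, rfl, rfl⟩
    refine ⟨y, x, h.symm, ?_, rfl, rfl⟩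
    congr 2
    exact Sym2.eq_swap
  eq_or_eq_of_isLink_of_isLink := by
    rintro q a b c d ⟨x, y, h, rfl, rfl, rfl⟩ ⟨x', y', h', hq, rfl, rfl⟩
    obtain ⟨g, hg⟩ := Quotient.exact hq
    simp only [Sym2.map_mk, Sym2.eq_iff] at hg
    rcases hg with ⟨h1, _⟩ | ⟨h1, _⟩
    · exact Or.inl (Quotient.sound ⟨g, h1⟩)
    · exact Or.inr (Quotient.sound ⟨g, h1⟩)
  left_mem_of_isLink := fun _ _ _ _ => Set.mem_univ _

end

/-- A rose with `n` petals: a graph with exactly one vertex and exactly `n` edges. -/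
def IsRose {α : Type u} {β : Type v} (G : Graph α β) (n : ℕ) : Prop :=
  (∃ x, G.vertexSet = {x}) ∧ G.edgeSet.encard = n

end TreeAction

/-! In a free action every nontrivial element translates along an axis, the set of vertices that it
moves least. If the axes of `g` and `h` are disjoint with bridge `[a, b]`, then `ℓ(gh) = ℓ(g) + ℓ(h)
+ 2 d(a, b)`; if they meet, then `ℓ(gh) ≤ ℓ(g) + ℓ(h)`. So lengths detect whether axes meet, and
measure the gap if they do not (`disjoint_axis_iff`, `IsBridge.elementLength_mul`).

Finiteness: an action is rebuilt from finitely many displacements `d(p, kp)` of one vertex. By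
minimality the translates of the segments `[p, sp]`, with `s` in a finite generating set, cover the
tree; by freeness only finitely many of them meet a given one. Distances between ends of meeting
segments define an equivariant locally injective map, which is an isometry of trees and is onto by
minimality of the target. In rank at least 2 some `g`, `h` have disjoint axes, and `p` is taken to
be the end `a` of their bridge. The axes of `g`, `gh`, `g⁻¹h` have only `a` in common, so for `k ≠
1` there are `s`, `t` among these three elements for which `[a, ka]` is the bridge between the axes
of `s` and `ktk⁻¹`. Hence `d(a, ka)` is read off from lengths. Ranks 0 and 1 are direct.

Roses: the elements moving a vertex `p` to a neighbour form a set of size `2n`, closed under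
inversion. They represent the classes of length 1; their nontrivial products `st` represent those of
length 2, and among such products `st` is conjugate only to itself and `ts`. In an action with the
same short lengths their axes meet pairwise, so by Helly they share a vertex `p'`. Displacements of
`p` up to 2 are then reproduced at `p'`, which suffices because all segments involved have length at
most 1. -/

namespace TreeAction

/-! ### Betweenness, medians and convex sets in trees -/

section Tree

variable {V : Type u} {T : SimpleGraph V}

/-- The vertex `b` lies on a geodesic from `a` to `c`. -/
def Between (T : SimpleGraph V) (a b c : V) : Prop :=
  T.dist a b + T.dist b c = T.dist a c

theorem Between.symm {a b c : V} (h : Between T a b c) : Between T c b a := by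
  unfold Between at *
  rw [T.dist_comm (u := c) (v := b), T.dist_comm (u := b) (v := a), T.dist_comm (u := c) (v := a)]
  omega

theorem between_left (a b : V) : Between T a a b := by
  simp [Between]

theorem between_right (a b : V) : Between T a b b := by
  simp [Between]

theorem dist_eq_zero (hT : T.IsTree) {a b : V} : T.dist a b = 0 ↔ a = b :=
  hT.connected.dist_eq_zero_iff

theorem between_of_mem_support {a b v : V} (p : T.Walk a b) (hp : p.length = T.dist a b)
    (hv : v ∈ p.support) : Between T a v b := by
  classical
  have h1 := congrArg SimpleGraph.Walk.length (p.take_spec hv)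
  rw [SimpleGraph.Walk.length_append] at h1
  have h2 := SimpleGraph.dist_le (p.takeUntil v hv)
  have h3 := SimpleGraph.dist_le (p.dropUntil v hv)
  have h4 : T.dist a b ≤ T.dist a v + T.dist v b := by
    obtain ⟨q, hq⟩ := (p.takeUntil v hv).reachable.exists_walk_length_eq_dist
    obtain ⟨r, hr⟩ := (p.dropUntil v hv).reachable.exists_walk_length_eq_dist
    rw [← hq, ← hr, ← SimpleGraph.Walk.length_append]
    exact SimpleGraph.dist_le _
  unfold Between
  omega

theorem mem_support_of_between (hT : T.IsTree) {a b v : V} (h : Between T a v b)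
    (p : T.Walk a b) : v ∈ p.support := by
  classical
  obtain ⟨q, hq⟩ := hT.connected.exists_walk_length_eq_dist a v
  obtain ⟨r, hr⟩ := hT.connected.exists_walk_length_eq_dist v b
  have hlen : (q.append r).length = T.dist a b := by
    rw [SimpleGraph.Walk.length_append, hq, hr]; exact h
  have hpath : (q.append r).IsPath := SimpleGraph.Walk.isPath_of_length_eq_dist _ hlen
  have heq : p.bypass = q.append r :=
    congrArg Subtype.val ((hT.isAcyclic.subsingleton_path a b).elim
      ⟨_, p.bypass_isPath⟩ ⟨_, hpath⟩)
  apply p.support_bypass_subset_support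
  rw [heq, SimpleGraph.Walk.mem_support_append_iff]
  exact Or.inl q.end_mem_support

/-- A detour from `a` to `b` through `c` still has to pass through `v`, on one of its two legs. Most
case distinctions below come from this. -/
theorem Between.or (hT : T.IsTree) {a b v : V} (h : Between T a v b) (c : V) :
    Between T a v c ∨ Between T b v c := by
  obtain ⟨q, hq⟩ := hT.connected.exists_walk_length_eq_dist a c
  obtain ⟨r, hr⟩ := hT.connected.exists_walk_length_eq_dist c b
  have := mem_support_of_between hT h (q.append r)
  rw [SimpleGraph.Walk.mem_support_append_iff] at this
  rcases this with h1 | h1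
  · exact Or.inl (between_of_mem_support q hq h1)
  · exact Or.inr (between_of_mem_support r hr h1).symm

/-- A point of a segment has the larger of the two obvious lower bounds as its distance to any
other point. -/
theorem Between.dist_eq_max (hT : T.IsTree) {a b v : V} (h : Between T a v b) (c : V) :
    (T.dist v c : ℤ) = max ((T.dist a c : ℤ) - T.dist a v) (T.dist b c - T.dist v b) := by
  have h1 := hT.connected.dist_triangle (u := a) (v := v) (w := c)
  have h2 := hT.connected.dist_triangle (u := b) (v := v) (w := c)
  rw [T.dist_comm (u := b) (v := v)] at h2
  rcases h.or hT c with h3 | h3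
  · unfold Between at h3; omega
  · unfold Between at h3
    rw [T.dist_comm (u := b) (v := v)] at h3
    omega

/-- Local geodesics in a tree are geodesics. The overlap `[b, c]` must be nondegenerate, since
otherwise the path could turn back at `b`. -/
theorem Between.concat (hT : T.IsTree) {a b c e : V} (h1 : Between T a b c)
    (h2 : Between T b c e) (hbc : b ≠ c) : Between T a c e := by
  have hpos : T.dist b c ≠ 0 := fun h => hbc ((dist_eq_zero hT).1 h)
  rcases h2.or hT a with h3 | h3
  · unfold Between at *
    rw [T.dist_comm (u := c) (v := a), T.dist_comm (u := b) (v := a)] at h3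
    omega
  · exact h3.symm

theorem Between.concat' (hT : T.IsTree) {a b c e : V} (h1 : Between T a b c)
    (h2 : Between T b c e) (hbc : b ≠ c) : Between T a b e := by
  have h3 := h1.concat hT h2 hbc
  unfold Between at *
  omega

/-- If `b` is on the way from `a` to `c` and `c` is on the way from `a` to `e`, then `b` is on the
way from `a` to `e`. -/
theorem Between.trans_left (hT : T.IsTree) {a b c e : V} (h1 : Between T a b c)
    (h2 : Between T a c e) : Between T a b e := by
  have h3 := hT.connected.dist_triangle (u := b) (v := c) (w := e)
  have h4 := hT.connected.dist_triangle (u := a) (v := b) (w := e)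
  unfold Between at *
  omega

theorem Between.trans_right (hT : T.IsTree) {a b c e : V} (h1 : Between T a b c)
    (h2 : Between T a c e) : Between T b c e := by
  have h3 := hT.connected.dist_triangle (u := b) (v := c) (w := e)
  have h4 := hT.connected.dist_triangle (u := a) (v := b) (w := e)
  unfold Between at *
  omega

theorem Between.eq_of_dist_eq (hT : T.IsTree) {a b c : V} (h : Between T a b c)
    (hd : T.dist a b = T.dist a c) : b = c := by
  unfold Between at h
  exact (dist_eq_zero hT).1 (by omega)

theorem exists_adj_between (hT : T.IsTree) {a v : V} (h : a ≠ v) :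
    ∃ w, T.Adj v w ∧ T.dist w a + 1 = T.dist v a := by
  obtain ⟨p, hp⟩ := hT.connected.exists_walk_length_eq_dist v a
  cases p with
  | nil => exact absurd rfl h
  | cons hadj q =>
    rename_i w
    refine ⟨w, hadj, ?_⟩
    have h1 := SimpleGraph.dist_le q
    have h2 := hT.connected.dist_triangle (u := v) (v := w) (w := a)
    rw [SimpleGraph.dist_eq_one_iff_adj.2 hadj] at h2
    rw [SimpleGraph.Walk.length_cons] at hp
    omega

theorem between_of_adj_of_ne (hT : T.IsTree) {w v w' : V} (h : T.Adj v w) (h' : T.Adj v w')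
    (hne : w ≠ w') : Between T w v w' := by
  have h1 : T.dist w v = 1 := SimpleGraph.dist_eq_one_iff_adj.2 h.symm
  have h2 : T.dist v w' = 1 := SimpleGraph.dist_eq_one_iff_adj.2 h'
  have h3 := hT.connected.dist_triangle (u := w) (v := v) (w := w')
  have h4 : T.dist w w' ≠ 0 := fun h => hne ((dist_eq_zero hT).1 h)
  have h5 : T.dist w w' ≠ 1 := by
    intro h5
    have hadj := SimpleGraph.dist_eq_one_iff_adj.1 h5
    have hp1 : (SimpleGraph.Walk.cons hadj SimpleGraph.Walk.nil).IsPath := by simp [hne]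
    have hp2 : (SimpleGraph.Walk.cons h.symm
        (SimpleGraph.Walk.cons h' SimpleGraph.Walk.nil)).IsPath := by
      simp [hne, h.ne', h'.ne]
    have := congrArg (fun p => p.1.length)
      ((hT.isAcyclic.subsingleton_path w w').elim ⟨_, hp1⟩ ⟨_, hp2⟩)
    simp at this
  unfold Between
  omega

theorem adj_dist_unique (hT : T.IsTree) {v w w' a : V} (h : T.Adj v w) (h' : T.Adj v w')
    (hw : T.dist w a + 1 = T.dist v a) (hw' : T.dist w' a + 1 = T.dist v a) : w = w' := by
  by_contra hne
  have h1 : T.dist v w = 1 := SimpleGraph.dist_eq_one_iff_adj.2 h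
  have h2 : T.dist v w' = 1 := SimpleGraph.dist_eq_one_iff_adj.2 h'
  rw [T.dist_comm] at h1 h2
  rcases (between_of_adj_of_ne hT h h' hne).or hT a with h3 | h3 <;>
  · unfold Between at h3
    omega

/-- If `v` is not between `a` and `b`, then some neighbour of `v` is nearer to both. -/
theorem exists_adj_of_not_between (hT : T.IsTree) {a v b : V} (h : ¬ Between T a v b) :
    ∃ w, T.Adj v w ∧ T.dist w a + 1 = T.dist v a ∧ T.dist w b + 1 = T.dist v b := by
  have hav : a ≠ v := by rintro rfl; exact h (between_left _ _)
  have hbv : b ≠ v := by rintro rfl; exact h (between_right _ _)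
  obtain ⟨w, hw, hwa⟩ := exists_adj_between hT hav
  obtain ⟨w', hw', hwb⟩ := exists_adj_between hT hbv
  by_cases hne : w = w'
  · subst hne; exact ⟨w, hw, hwa, hwb⟩
  exfalso
  apply h
  have h1 : T.dist v w = 1 := SimpleGraph.dist_eq_one_iff_adj.2 hw
  have h2 : T.dist v w' = 1 := SimpleGraph.dist_eq_one_iff_adj.2 hw'
  have b1 : Between T a w v := by
    unfold Between
    rw [T.dist_comm (u := a) (v := w), T.dist_comm (u := w) (v := v),
      T.dist_comm (u := a) (v := v)]
    omega
  have b2 : Between T v w' b := by unfold Between; omega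
  exact (b1.concat hT (between_of_adj_of_ne hT hw hw' hne) hw.ne').concat' hT b2 hw'.ne

theorem dist_of_adj_of_not_between (hT : T.IsTree) {w x z : V} (h : T.Adj x w)
    (hn : ¬ Between T w x z) : T.dist w z + 1 = T.dist x z := by
  obtain ⟨y, hy, h1, h2⟩ := exists_adj_of_not_between hT hn
  have h3 : T.dist x w = 1 := SimpleGraph.dist_eq_one_iff_adj.2 h
  have : y = w := (dist_eq_zero hT).1 (by omega)
  rwa [this] at h2

theorem exists_between_dist (hT : T.IsTree) (a b : V) {m : ℕ} (hm : m ≤ T.dist a b) :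
    ∃ v, Between T a v b ∧ T.dist a v = m := by
  induction m with
  | zero => exact ⟨a, between_left _ _, by simp⟩
  | succ m ih =>
    obtain ⟨v, hv, hd⟩ := ih (by omega)
    have hne : b ≠ v := by
      rintro rfl
      omega
    obtain ⟨w, hw, hwb⟩ := exists_adj_between hT hne
    have h1 : T.dist v w = 1 := SimpleGraph.dist_eq_one_iff_adj.2 hw
    have h2 := hT.connected.dist_triangle (u := a) (v := v) (w := w)
    have h3 := hT.connected.dist_triangle (u := a) (v := w) (w := b)
    unfold Between at *
    exact ⟨w, by omega, by omega⟩

/-- Any three vertices of a tree have a median. -/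
theorem exists_median (hT : T.IsTree) (x y z : V) :
    ∃ c, Between T x c y ∧ Between T y c z ∧ Between T x c z := by
  -- The median minimises the sum of the three distances: if it missed one of the segments, some
  -- neighbour would be nearer to two of the points and at most one step farther from the third.
  obtain ⟨c, hc⟩ : ∃ c, ∀ c', T.dist c x + T.dist c y + T.dist c z ≤
      T.dist c' x + T.dist c' y + T.dist c' z := by
    have : Nonempty V := ⟨x⟩
    exact ⟨_, fun c' => Function.argmin_le (fun c => T.dist c x + T.dist c y + T.dist c z) c'⟩
  have tri : ∀ w, T.Adj c w → ∀ t, T.dist w t ≤ T.dist c t + 1 := by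
    intro w hw t
    have := hT.connected.dist_triangle (u := w) (v := c) (w := t)
    rw [SimpleGraph.dist_eq_one_iff_adj.2 hw.symm] at this
    omega
  refine ⟨c, ?_, ?_, ?_⟩ <;>
  · by_contra h
    obtain ⟨w, hw, h1, h2⟩ := exists_adj_of_not_between hT h
    have h3 := hc w
    have := tri w hw x
    have := tri w hw y
    have := tri w hw z
    omega

theorem Between.dist_eq_of_dist_eq (hT : T.IsTree) {V' : Type v} {T' : SimpleGraph V'}
    (hT' : T'.IsTree) {a b v c : V} {a' b' v' c' : V'} (h : Between T a v b)
    (h' : Between T' a' v' b') (hab : T'.dist a' b' = T.dist a b)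
    (hav : T'.dist a' v' = T.dist a v) (hac : T'.dist a' c' = T.dist a c)
    (hbc : T'.dist b' c' = T.dist b c) : T'.dist v' c' = T.dist v c := by
  have h1 := h.dist_eq_max hT c
  have h2 := h'.dist_eq_max hT' c'
  unfold Between at h h'
  have : T'.dist v' b' = T.dist v b := by omega
  rw [hav, hac, hbc, this, ← h1] at h2
  exact_mod_cast h2

/-- Two trees in which four vertices have the same distances have the same distances between
corresponding points of the segments spanned by them. -/
theorem dist_eq_of_segments (hT : T.IsTree) {V' : Type v} {T' : SimpleGraph V'}
    (hT' : T'.IsTree) {a b c e v w : V} {a' b' c' e' v' w' : V'} (h : Between T a v b)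
    (h' : Between T' a' v' b') (hab : T'.dist a' b' = T.dist a b)
    (hav : T'.dist a' v' = T.dist a v)
    (k : Between T c w e) (k' : Between T' c' w' e') (hce : T'.dist c' e' = T.dist c e)
    (hcw : T'.dist c' w' = T.dist c w)
    (hac : T'.dist a' c' = T.dist a c) (hae : T'.dist a' e' = T.dist a e)
    (hbc : T'.dist b' c' = T.dist b c) (hbe : T'.dist b' e' = T.dist b e) :
    T'.dist v' w' = T.dist v w := by
  have h1 := h.dist_eq_of_dist_eq hT hT' h' hab hav hac hbc
  have h2 := h.dist_eq_of_dist_eq hT hT' h' hab hav hae hbe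
  rw [T'.dist_comm, T.dist_comm (u := v)] at h1 h2 ⊢
  exact k.dist_eq_of_dist_eq hT hT' k' hce hcw h1 h2

/-- A set of vertices containing all segments between its points. -/
def IsConvex (T : SimpleGraph V) (A : Set V) : Prop :=
  ∀ x ∈ A, ∀ y ∈ A, ∀ z, Between T x z y → z ∈ A

/-- If the first step from `x` towards `y` leaves `A`, then `x` is the projection of `y`. Otherwise
that step would also lead towards some `a ∈ A`, and convexity would put it in `A`. -/
theorem between_of_adj_not_mem (hT : T.IsTree) {A : Set V} (hA : IsConvex T A) {x y w : V}
    (hx : x ∈ A) (hw : T.Adj x w) (hwy : T.dist w y + 1 = T.dist x y) (hwA : w ∉ A) :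
    ∀ a ∈ A, Between T y x a := by
  intro a ha
  by_contra h
  obtain ⟨z, hz, h1, h2⟩ := exists_adj_of_not_between hT h
  obtain rfl := adj_dist_unique hT hw hz hwy h1
  refine hwA (hA x hx a ha w ?_)
  unfold Between
  rw [SimpleGraph.dist_eq_one_iff_adj.2 hw]
  omega

theorem IsConvex.exists_proj (hT : T.IsTree) {A : Set V} (hA : IsConvex T A) (hne : A.Nonempty)
    (y : V) : ∃ x ∈ A, ∀ a ∈ A, Between T y x a := by
  refine ⟨_, Function.argminOn_mem (fun x => T.dist x y) A hne, fun a ha => ?_⟩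
  set x := Function.argminOn (fun x => T.dist x y) A hne
  by_contra h
  obtain ⟨w, hw, h1, h2⟩ := exists_adj_of_not_between hT h
  have hx : x ∈ A := Function.argminOn_mem _ A hne
  have hwA : w ∈ A := by
    refine hA x hx a ha w ?_
    unfold Between
    rw [SimpleGraph.dist_eq_one_iff_adj.2 hw]
    omega
  have h3 : T.dist x y ≤ T.dist w y := Function.argminOn_le (fun x => T.dist x y) A hwA
  omega

/-- Helly's theorem for three convex sets in a tree. -/
theorem IsConvex.helly (hT : T.IsTree) {A B C : Set V} (hA : IsConvex T A) (hB : IsConvex T B)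
    (hC : IsConvex T C) (hAB : (A ∩ B).Nonempty) (hBC : (B ∩ C).Nonempty)
    (hAC : (A ∩ C).Nonempty) : (A ∩ B ∩ C).Nonempty := by
  obtain ⟨p, hpA, hpB⟩ := hAB
  obtain ⟨z, hzB, hzC⟩ := hBC
  obtain ⟨q, hqA, hqC⟩ := hAC
  obtain ⟨m, hm, hproj⟩ := hA.exists_proj hT ⟨p, hpA⟩ z
  -- The projection of `z ∈ B ∩ C` to `A` lies on `[z, p]`, inside `B`, and on `[z, q]`, inside `C`.
  exact ⟨m, ⟨hm, hB z hzB p hpB m (hproj p hpA)⟩, hC z hzC q hqC m (hproj q hqA)⟩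

theorem IsConvex.exists_bridge (hT : T.IsTree) {A B : Set V} (hA : IsConvex T A)
    (hB : IsConvex T B) (hAn : A.Nonempty) (hBn : B.Nonempty) (hd : Disjoint A B) :
    ∃ a ∈ A, ∃ b ∈ B, a ≠ b ∧ (∀ x ∈ A, Between T b a x) ∧ (∀ y ∈ B, Between T a b y) := by
  obtain ⟨b₀, hb₀⟩ := hBn
  obtain ⟨a, ha, hpa⟩ := hA.exists_proj hT hAn b₀
  obtain ⟨b, hb, hpb⟩ := hB.exists_proj hT ⟨b₀, hb₀⟩ a
  refine ⟨a, ha, b, hb, ?_, fun x hx => ?_, hpb⟩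
  · rintro rfl
    exact Set.disjoint_left.1 hd ha hb
  · exact (hpb b₀ hb₀).symm.trans_right hT (hpa x hx)

end Tree

/-! ### Axes of group elements and lengths of products -/

section Axis

variable {Γ : Type w} [Group Γ] {V : Type u} {T : SimpleGraph V} {ρ : Γ →* (T ≃g T)}

theorem mul_apply (g h : Γ) (x : V) : ρ (g * h) x = ρ g (ρ h x) := by
  rw [map_mul, RelIso.mul_apply]

theorem one_apply (x : V) : ρ 1 x = x := by simp

theorem inv_apply_apply (g : Γ) (x : V) : ρ g⁻¹ (ρ g x) = x := by
  rw [← mul_apply, inv_mul_cancel, one_apply]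

theorem apply_inv_apply (g : Γ) (x : V) : ρ g (ρ g⁻¹ x) = x := by
  rw [← mul_apply, mul_inv_cancel, one_apply]

theorem Between.map {a b c : V} (h : Between T a b c) (g : Γ) :
    Between T (ρ g a) (ρ g b) (ρ g c) := by
  unfold Between
  rw [dist_iso, dist_iso, dist_iso]
  exact h

theorem dist_inv_apply (g : Γ) (x y : V) : T.dist (ρ g⁻¹ x) y = T.dist x (ρ g y) := by
  rw [← dist_iso (ρ g), apply_inv_apply]

theorem dist_apply_inv (g : Γ) (x : V) : T.dist x (ρ g⁻¹ x) = T.dist x (ρ g x) := by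
  rw [T.dist_comm, dist_inv_apply]

theorem IsFree.apply_ne (hfree : IsFree ρ) {g : Γ} (hg : g ≠ 1) (x : V) : ρ g x ≠ x :=
  (hfree g hg).1 x

theorem IsFree.eq_of_apply_eq (hfree : IsFree ρ) {g h : Γ} {x : V} (e : ρ g x = ρ h x) :
    g = h := by
  by_contra hne
  refine hfree.apply_ne (g := h⁻¹ * g) (fun h1 => hne (inv_mul_eq_one.1 h1).symm) x ?_
  rw [mul_apply, e, inv_apply_apply]

theorem IsFree.not_adj_swap (hfree : IsFree ρ) {g : Γ} {x : V} (h : T.Adj x (ρ g x)) :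
    ρ g (ρ g x) ≠ x := by
  intro e
  have hg : g ≠ 1 := by
    rintro rfl
    rw [one_apply] at h
    exact h.ne rfl
  refine (hfree g hg).2 s(x, ρ g x) h ?_
  rw [Sym2.map_mk, e, Sym2.eq_swap]

theorem elementLength_le (ρ : Γ →* (T ≃g T)) (g : Γ) (x : V) :
    elementLength ρ g ≤ T.dist x (ρ g x) :=
  ciInf_le' _ x

/-- The vertices moved the least by a group element. -/
def axis (ρ : Γ →* (T ≃g T)) (g : Γ) : Set V :=
  {x | T.dist x (ρ g x) = elementLength ρ g}

theorem axis_nonempty (hT : T.IsTree) (ρ : Γ →* (T ≃g T)) (g : Γ) : (axis ρ g).Nonempty := by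
  have := hT.connected.nonempty
  obtain ⟨x, hx⟩ := Nat.sInf_mem (Set.range_nonempty fun x : V => T.dist x (ρ g x))
  exact ⟨x, hx⟩

theorem elementLength_pos (hT : T.IsTree) (hfree : IsFree ρ) {g : Γ} (hg : g ≠ 1) :
    0 < elementLength ρ g := by
  obtain ⟨x, hx⟩ := axis_nonempty hT ρ g
  rw [← hx]
  exact Nat.pos_of_ne_zero fun h => hfree.apply_ne hg x ((dist_eq_zero hT).1 h).symm

/-- Displacement is convex along a segment: two applications of `Between.dist_eq_max` bound `d(z,
gz)` by the common displacement of the ends. -/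
theorem axis_convex (hT : T.IsTree) (ρ : Γ →* (T ≃g T)) (g : Γ) : IsConvex T (axis ρ g) := by
  intro x hx y hy z hz
  refine le_antisymm ?_ (elementLength_le ρ g z)
  have h1 := hz.dist_eq_max hT (ρ g z)
  have h2 := (hz.map (ρ := ρ) g).dist_eq_max hT x
  have h3 := (hz.map (ρ := ρ) g).dist_eq_max hT y
  have h4 := hT.connected.dist_triangle (u := x) (v := y) (w := ρ g y)
  have h5 := hT.connected.dist_triangle (u := y) (v := x) (w := ρ g x)
  rw [T.dist_comm (u := y) (v := x)] at h5
  rw [T.dist_comm (u := ρ g x) (v := x), T.dist_comm (u := ρ g y) (v := x),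
    T.dist_comm (u := ρ g z) (v := x), dist_iso, dist_iso] at h2
  rw [T.dist_comm (u := ρ g x) (v := y), T.dist_comm (u := ρ g y) (v := y),
    T.dist_comm (u := ρ g z) (v := y), dist_iso, dist_iso] at h3
  unfold Between at hz
  change T.dist x (ρ g x) = _ at hx
  change T.dist y (ρ g y) = _ at hy
  omega

theorem apply_mem_axis {g h : Γ} {x : V} (hx : x ∈ axis ρ g) :
    ρ h x ∈ axis ρ (h * g * h⁻¹) := by
  change T.dist _ _ = _
  rw [elementLength_conj, mul_apply, inv_apply_apply, mul_apply, dist_iso]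
  exact hx

theorem apply_self_mem_axis {g : Γ} {x : V} (hx : x ∈ axis ρ g) : ρ g x ∈ axis ρ g := by
  simpa using apply_mem_axis (h := g) hx

theorem apply_inv_self_mem_axis {g : Γ} {x : V} (hx : x ∈ axis ρ g) : ρ g⁻¹ x ∈ axis ρ g := by
  simpa using apply_mem_axis (h := g⁻¹) hx

theorem apply_pow_mem_axis {g : Γ} {x : V} (hx : x ∈ axis ρ g) (m : ℕ) :
    ρ (g ^ m) x ∈ axis ρ g := by
  have := apply_mem_axis (h := g ^ m) hx
  rwa [← pow_succ, pow_succ', mul_inv_cancel_right] at this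

theorem elementLength_inv (ρ : Γ →* (T ≃g T)) (g : Γ) :
    elementLength ρ g⁻¹ = elementLength ρ g := by
  unfold elementLength
  simp_rw [dist_apply_inv]

theorem axis_inv (ρ : Γ →* (T ≃g T)) (g : Γ) : axis ρ g⁻¹ = axis ρ g := by
  unfold axis
  simp_rw [dist_apply_inv, elementLength_inv]

/-- If the path turned back at `x`, a neighbour `w` of `x` would be moved two steps less than `x`,
or, at length one, `g` would invert the edge `xw`, which freeness excludes. -/
theorem between_of_mem_axis (hT : T.IsTree) (hfree : IsFree ρ) {g : Γ} (hg : g ≠ 1) {x : V}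
    (hx : x ∈ axis ρ g) : Between T (ρ g⁻¹ x) x (ρ g x) := by
  by_contra h
  obtain ⟨w, hw, h1, h2⟩ := exists_adj_of_not_between hT h
  have hpos := elementLength_pos hT hfree hg
  have hxw := SimpleGraph.dist_eq_one_iff_adj.2 hw
  have hmin := elementLength_le ρ g w
  change T.dist x (ρ g x) = _ at hx
  rw [dist_apply_inv, T.dist_comm, dist_inv_apply, T.dist_comm] at h1
  have hgw : T.dist (ρ g x) (ρ g w) = 1 := by rw [dist_iso, hxw]
  have b1 : Between T x w (ρ g x) := by unfold Between; omega
  rcases Nat.lt_or_ge (elementLength ρ g) 2 with hl | hl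
  · have e1 : w = ρ g x := (dist_eq_zero hT).1 (by omega)
    have e2 : ρ g w = x := (dist_eq_zero hT).1 (by omega)
    rw [e1] at e2 hw
    exact hfree.not_adj_swap hw e2
  · rcases b1.or hT (ρ g w) with b2 | b2
    · unfold Between at b2
      rw [T.dist_comm (u := x) (v := ρ g w)] at b2
      omega
    · unfold Between at b2
      rw [T.dist_comm (u := ρ g x) (v := w)] at b2
      omega

/-- The path `y, c, hc, hy` is geodesic: it leaves `A` at `c` and at `hc` along the shortest routes
to `y` and `hy`. -/
theorem dist_apply_of_proj (hT : T.IsTree) {A : Set V} {y c : V}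
    (hp : ∀ a ∈ A, Between T y c a) {h : Γ} (h1 : ρ h c ∈ A) (h2 : ρ h⁻¹ c ∈ A)
    (hne : ρ h c ≠ c) : T.dist y (ρ h y) = 2 * T.dist y c + T.dist c (ρ h c) := by
  have b1 := hp _ h1
  have b2 := (hp _ h2).symm.map (ρ := ρ) h
  rw [apply_inv_apply] at b2
  have b3 := b1.concat hT b2 hne.symm
  unfold Between at b1 b3
  rw [dist_iso, T.dist_comm (u := c)] at b3
  omega

/-- At distance `r` from the axis, `g` moves `x` by `2r + ℓ` and `g²` moves it by `2r + 2ℓ`.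
Betweenness makes the second twice the first, so `r = 0`. -/
theorem mem_axis_of_between (hT : T.IsTree) (hfree : IsFree ρ) {g : Γ} (hg : g ≠ 1) {x : V}
    (hx : Between T (ρ g⁻¹ x) x (ρ g x)) : x ∈ axis ρ g := by
  obtain ⟨c, hc, hp⟩ := (axis_convex hT ρ g).exists_proj hT (axis_nonempty hT ρ g) x
  have b := between_of_mem_axis hT hfree hg hc
  have hpos := elementLength_pos hT hfree hg
  have e1 := dist_apply_of_proj hT hp (apply_self_mem_axis hc) (apply_inv_self_mem_axis hc)
    (hfree.apply_ne hg c)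
  have hl : T.dist c (ρ g c) = _ := hc
  unfold Between at hx b
  rw [dist_inv_apply] at hx b
  rw [dist_inv_apply, ← mul_apply] at hx b
  have hne : ρ (g * g) c ≠ c := by
    intro h
    rw [h, SimpleGraph.dist_self] at b
    omega
  have e2 := dist_apply_of_proj (h := g * g) hT hp
    (by rw [mul_apply]; exact apply_self_mem_axis (apply_self_mem_axis hc))
    (by rw [mul_inv_rev, mul_apply]; exact apply_inv_self_mem_axis (apply_inv_self_mem_axis hc)) hne
  change T.dist _ _ = _
  omega

theorem exists_dist_eq_add (hT : T.IsTree) (hfree : IsFree ρ) {g : Γ} (hg : g ≠ 1) (x : V) :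
    ∃ r, T.dist x (ρ g x) = 2 * r + elementLength ρ g := by
  obtain ⟨c, hc, hp⟩ := (axis_convex hT ρ g).exists_proj hT (axis_nonempty hT ρ g) x
  have h := dist_apply_of_proj hT hp (apply_self_mem_axis hc) (apply_inv_self_mem_axis hc)
    (hfree.apply_ne hg c)
  have hl : T.dist c (ρ g c) = _ := hc
  exact ⟨_, by rw [h, hl]⟩

/-- An axis does not branch. -/
theorem axis_not_branching (hT : T.IsTree) (hfree : IsFree ρ) {g : Γ} (hg : g ≠ 1) {x w : V}
    (hx : x ∈ axis ρ g) (hw : w ∈ axis ρ g) (hne : w ≠ x) (h1 : Between T w x (ρ g x))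
    (h2 : Between T w x (ρ g⁻¹ x)) : False := by
  have b2 := h2.symm.map (ρ := ρ) g
  rw [apply_inv_apply] at b2
  have b3 := h1.concat hT b2 (hfree.apply_ne hg x).symm
  have : T.dist w x ≠ 0 := fun h => hne ((dist_eq_zero hT).1 h)
  have hl : T.dist x (ρ g x) = _ := hx
  have hl' : T.dist w (ρ g w) = _ := hw
  unfold Between at h1 b3
  omega

theorem axis_trichotomy (hT : T.IsTree) (hfree : IsFree ρ) {g : Γ} (hg : g ≠ 1) {x y z : V}
    (hx : x ∈ axis ρ g) (hy : y ∈ axis ρ g) (hz : z ∈ axis ρ g) :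
    Between T x y z ∨ Between T y z x ∨ Between T z x y := by
  obtain ⟨c, h1, h2, h3⟩ := exists_median hT x y z
  have hc := axis_convex hT ρ g x hx y hy c h1
  by_cases e1 : x = c
  · subst e1; exact Or.inr (Or.inr h2.symm)
  by_cases e2 : y = c
  · subst e2; exact Or.inl h3
  by_cases e3 : z = c
  · subst e3; exact Or.inr (Or.inl h1.symm)
  exfalso
  -- At a median distinct from all three points, `c` separates `gc` from at least two of them, and
  -- likewise `g⁻¹c`. So some point is separated from both, and the axis would branch at `c`.
  have n1 := axis_not_branching hT hfree hg hc hx e1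
  have n2 := axis_not_branching hT hfree hg hc hy e2
  have n3 := axis_not_branching hT hfree hg hc hz e3
  have a1 := h1.or hT (ρ g c)
  have a2 := h2.or hT (ρ g c)
  have a3 := h3.or hT (ρ g c)
  have b1 := h1.or hT (ρ g⁻¹ c)
  have b2 := h2.or hT (ρ g⁻¹ c)
  have b3 := h3.or hT (ρ g⁻¹ c)
  clear h1 h2 h3 hx hy hz hc
  grind

theorem between_pow_succ (hT : T.IsTree) (hfree : IsFree ρ) {g : Γ} (hg : g ≠ 1) {x : V}
    (hx : x ∈ axis ρ g) (m : ℕ) : Between T x (ρ (g ^ m) x) (ρ (g ^ (m + 1)) x) := by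
  induction m with
  | zero => simpa using between_left x (ρ g x)
  | succ m ih =>
    refine ih.concat hT ?_ ?_
    · have := (between_of_mem_axis hT hfree hg hx).map (ρ := ρ) (g ^ (m + 1))
      rw [← mul_apply, ← mul_apply, ← pow_succ, pow_succ g m, mul_inv_cancel_right,
        ← pow_succ] at this
      exact this
    · rw [pow_succ, mul_apply]
      exact fun h => hfree.apply_ne hg x ((ρ (g ^ m)).injective h).symm

theorem dist_pow_apply (hT : T.IsTree) (hfree : IsFree ρ) {g : Γ} (hg : g ≠ 1) {x : V}
    (hx : x ∈ axis ρ g) (m : ℕ) : T.dist x (ρ (g ^ m) x) = m * elementLength ρ g := by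
  induction m with
  | zero => simp
  | succ m ih =>
    have := between_pow_succ hT hfree hg hx m
    unfold Between at this
    rw [← this, ih, pow_succ, mul_apply, dist_iso, add_mul, one_mul]
    exact congrArg _ hx

theorem dist_zpow_apply (hT : T.IsTree) (hfree : IsFree ρ) {g : Γ} (hg : g ≠ 1) {x : V}
    (hx : x ∈ axis ρ g) (m : ℤ) :
    T.dist x (ρ (g ^ m) x) = m.natAbs * elementLength ρ g := by
  rcases Int.natAbs_eq m with h | h
  · conv_lhs => rw [h]
    rw [zpow_natCast, dist_pow_apply hT hfree hg hx]
  · conv_lhs => rw [h]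
    rw [zpow_neg, dist_apply_inv, zpow_natCast, dist_pow_apply hT hfree hg hx]

theorem between_apply_pow (hT : T.IsTree) (hfree : IsFree ρ) {g : Γ} (hg : g ≠ 1) {x : V}
    (hx : x ∈ axis ρ g) {m : ℕ} (hm : m ≠ 0) : Between T x (ρ g x) (ρ (g ^ m) x) := by
  obtain ⟨m, rfl⟩ := Nat.exists_eq_succ_of_ne_zero hm
  induction m with
  | zero => simpa using between_right x (ρ g x)
  | succ m ih => exact (ih (by omega)).trans_left hT (between_pow_succ hT hfree hg hx (m + 1))

theorem eq_pow_apply_of_not_between (hT : T.IsTree) (hfree : IsFree ρ) {g : Γ} (hg : g ≠ 1)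
    {x y : V} (hx : x ∈ axis ρ g) (hy : y ∈ axis ρ g) {m : ℕ} (hm : m ≠ 0)
    (hd : T.dist x y = m * elementLength ρ g) (hn : ¬ Between T y x (ρ g x)) :
    y = ρ (g ^ m) x := by
  have hd' := dist_pow_apply hT hfree hg hx m
  rcases axis_trichotomy hT hfree hg hx hy (apply_pow_mem_axis hx m) with h | h | h
  · exact h.eq_of_dist_eq hT (by rw [hd, hd'])
  · exact (h.symm.eq_of_dist_eq hT (by rw [hd, hd'])).symm
  · exact absurd ((between_apply_pow hT hfree hg hx hm).symm.trans_right hT h).symm hn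

theorem eq_pow_apply_or (hT : T.IsTree) (hfree : IsFree ρ) {g : Γ} (hg : g ≠ 1)
    {x y : V} (hx : x ∈ axis ρ g) (hy : y ∈ axis ρ g) {m : ℕ} (hm : m ≠ 0)
    (hd : T.dist x y = m * elementLength ρ g) :
    y = ρ (g ^ m) x ∨ y = ρ (g⁻¹ ^ m) x := by
  by_cases h1 : Between T y x (ρ g x)
  · right
    refine eq_pow_apply_of_not_between hT hfree (inv_ne_one.2 hg) (by rwa [axis_inv])
      (by rwa [axis_inv]) hm (by rwa [elementLength_inv]) fun h2 => ?_
    refine axis_not_branching hT hfree hg hx hy ?_ h1 h2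
    rintro rfl
    have := elementLength_pos hT hfree hg
    rw [SimpleGraph.dist_self] at hd
    exact (Nat.mul_ne_zero hm this.ne') hd.symm
  · exact Or.inl (eq_pow_apply_of_not_between hT hfree hg hx hy hm hd h1)

theorem elementLength_mul_le (hT : T.IsTree) (ρ : Γ →* (T ≃g T)) {g h : Γ} {x y : V}
    (hx : x ∈ axis ρ g) (hy : y ∈ axis ρ h) :
    elementLength ρ (g * h) ≤ elementLength ρ g + elementLength ρ h + 2 * T.dist x y := by
  -- The test vertex `h⁻¹y` is sent to `gy`.
  have h0 := elementLength_le ρ (g * h) (ρ h⁻¹ y)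
  rw [mul_apply, apply_inv_apply, dist_inv_apply] at h0
  have h1 := hT.connected.dist_triangle (u := y) (v := ρ h y) (w := ρ h (ρ g y))
  have e : T.dist (ρ h⁻¹ y) (ρ g y) = T.dist y (ρ h (ρ g y)) := dist_inv_apply _ _ _
  have h2 := hT.connected.dist_triangle (u := y) (v := x) (w := ρ g y)
  have h3 := hT.connected.dist_triangle (u := x) (v := ρ g x) (w := ρ g y)
  rw [dist_iso] at h1 h3
  have hx' : T.dist x (ρ g x) = _ := hx
  have hy' : T.dist y (ρ h y) = _ := hy
  rw [T.dist_comm (u := y) (v := x)] at h2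
  omega

/-- The data attached to two elements with disjoint axes and the bridge `[a, b]` between them. -/
structure IsBridge (ρ : Γ →* (T ≃g T)) (g h : Γ) (a b : V) : Prop where
  ne : a ≠ b
  left_mem : a ∈ axis ρ g
  right_mem : b ∈ axis ρ h
  left_proj : ∀ x ∈ axis ρ g, Between T b a x
  right_proj : ∀ y ∈ axis ρ h, Between T a b y

theorem exists_isBridge (hT : T.IsTree) {g h : Γ} (hd : Disjoint (axis ρ g) (axis ρ h)) :
    ∃ a b, IsBridge ρ g h a b := by
  obtain ⟨a, ha, b, hb, hne, h1, h2⟩ := (axis_convex hT ρ g).exists_bridge hT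
    (axis_convex hT ρ h) (axis_nonempty hT ρ g) (axis_nonempty hT ρ h) hd
  exact ⟨a, b, hne, ha, hb, h1, h2⟩

theorem IsBridge.inv_left {g h : Γ} {a b : V} (hb : IsBridge ρ g h a b) :
    IsBridge ρ g⁻¹ h a b :=
  ⟨hb.ne, by rw [axis_inv]; exact hb.2, hb.3, by rw [axis_inv]; exact hb.4, hb.5⟩

/-- The path `a, ga, gb, ghb, gha` is geodesic, because consecutive pieces continue each other and
the overlaps are nondegenerate. -/
theorem IsBridge.right_chain (hT : T.IsTree) (hfree : IsFree ρ) {g h : Γ}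
    (hh : h ≠ 1) {a b : V} (hb : IsBridge ρ g h a b) :
    Between T a (ρ g a) (ρ (g * h) a) ∧
      T.dist a (ρ (g * h) a) = elementLength ρ g + elementLength ρ h + 2 * T.dist a b := by
  have r1 := (hb.left_proj _ (apply_inv_self_mem_axis hb.left_mem)).symm.map (ρ := ρ) g
  rw [apply_inv_apply] at r1
  have r2 := (hb.right_proj _ (apply_self_mem_axis hb.right_mem)).map (ρ := ρ) g
  have r3 := (hb.right_proj _ (apply_inv_self_mem_axis hb.right_mem)).symm.map (ρ := ρ) (g * h)
  rw [mul_apply, mul_apply, apply_inv_apply] at r3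
  have n1 : ρ g a ≠ ρ g b := (ρ g).injective.ne hb.ne
  have n2 : ρ g b ≠ ρ g (ρ h b) := (ρ g).injective.ne (hfree.apply_ne hh b).symm
  have s1 := r1.concat hT r2 n1
  have s2 := r1.concat' hT r2 n1
  have s3 := s1.concat hT r3 n2
  have hx' : T.dist a (ρ g a) = _ := hb.left_mem
  have hy' : T.dist b (ρ h b) = _ := hb.right_mem
  refine ⟨s2.trans_left hT s3, ?_⟩
  unfold Between at r1 s1 s3
  rw [mul_apply] at s3 ⊢
  simp only [dist_iso] at *
  rw [T.dist_comm (u := b) (v := a)] at s3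
  omega

/-- The same argument for the path `a, b, h⁻¹b, h⁻¹a, h⁻¹g⁻¹a`. With `right_chain` it shows that the
axis of `gh` passes through `a`, coming from the bridge and leaving along the axis of `g`. -/
theorem IsBridge.left_chain (hT : T.IsTree) (hfree : IsFree ρ) {g h : Γ}
    (hh : h ≠ 1) {a b : V} (hb : IsBridge ρ g h a b) :
    Between T a b (ρ (g * h)⁻¹ a) := by
  have r1 := hb.right_proj _ (apply_inv_self_mem_axis hb.right_mem)
  have r2 := (hb.right_proj _ (apply_self_mem_axis hb.right_mem)).symm.map (ρ := ρ) h⁻¹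
  rw [inv_apply_apply] at r2
  have r3 := (hb.left_proj _ (apply_inv_self_mem_axis hb.left_mem)).map (ρ := ρ) h⁻¹
  rw [← mul_apply, ← mul_inv_rev] at r3
  have n1 : b ≠ ρ h⁻¹ b := (hfree.apply_ne (inv_ne_one.2 hh) b).symm
  have n2 : ρ h⁻¹ b ≠ ρ h⁻¹ a := (ρ h⁻¹).injective.ne hb.ne.symm
  exact (r1.concat' hT r2 n1).trans_left hT ((r1.concat hT r2 n1).concat hT r3 n2)

theorem IsBridge.left_mem_axis_mul (hT : T.IsTree) (hfree : IsFree ρ) {g h : Γ} (hg : g ≠ 1)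
    (hh : h ≠ 1) {a b : V} (hb : IsBridge ρ g h a b) : a ∈ axis ρ (g * h) := by
  obtain ⟨h1, h2⟩ := hb.right_chain hT hfree hh
  have h3 := hb.left_chain hT hfree hh
  have hpos := elementLength_pos hT hfree hg
  refine mem_axis_of_between hT hfree ?_ ?_
  · intro e
    rw [e, one_apply, SimpleGraph.dist_self] at h2
    omega
  · exact (h3.symm.concat hT (hb.left_proj _ (apply_self_mem_axis hb.left_mem))
      hb.ne.symm).concat' hT h1 (hfree.apply_ne hg a).symm

theorem IsBridge.elementLength_mul (hT : T.IsTree) (hfree : IsFree ρ) {g h : Γ} (hg : g ≠ 1)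
    (hh : h ≠ 1) {a b : V} (hb : IsBridge ρ g h a b) :
    elementLength ρ (g * h) = elementLength ρ g + elementLength ρ h + 2 * T.dist a b := by
  have h1 : T.dist _ _ = _ := hb.left_mem_axis_mul hT hfree hg hh
  rw [← h1, (hb.right_chain hT hfree hh).2]

theorem disjoint_axis_iff (hT : T.IsTree) (hfree : IsFree ρ) {g h : Γ} (hg : g ≠ 1)
    (hh : h ≠ 1) : Disjoint (axis ρ g) (axis ρ h) ↔
      elementLength ρ g + elementLength ρ h < elementLength ρ (g * h) := by
  constructor
  · intro hd
    obtain ⟨a, b, hb⟩ := exists_isBridge hT hd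
    have := hT.connected.pos_dist_of_ne hb.ne
    rw [hb.elementLength_mul hT hfree hg hh]
    omega
  · intro hlt
    rw [Set.disjoint_left]
    intro x hx hy
    have := elementLength_mul_le hT ρ hx hy
    rw [SimpleGraph.dist_self] at this
    omega

end Axis

/-! ### Reconstructing an action from distances between ends of segments -/

section Extension

variable {Γ : Type w} [Group Γ] {V : Type u} {T : SimpleGraph V} {ρ : Γ →* (T ≃g T)}
  {V' : Type v} {T' : SimpleGraph V'} {ρ' : Γ →* (T' ≃g T')}

/-- A locally injective morphism of trees is an isometry. -/
theorem dist_map_eq_of_locally_injective (hT : T.IsTree) (hT' : T'.IsTree) {F : V → V'}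
    (hadj : ∀ v w, T.Adj v w → T'.Adj (F v) (F w))
    (hinj : ∀ v w₁ w₂, T.Adj v w₁ → T.Adj v w₂ → w₁ ≠ w₂ → F w₁ ≠ F w₂) (v w : V) :
    T'.dist (F v) (F w) = T.dist v w := by
  have key : ∀ m w, T.dist v w = m → T'.dist (F v) (F w) = m := by
    intro m
    induction m using Nat.strong_induction_on with
    | _ m ih =>
      intro w hm
      by_cases hvw : v = w
      · subst hvw; simp at hm ⊢; exact hm
      obtain ⟨x, hx, hxd⟩ := exists_adj_between hT hvw
      rw [T.dist_comm (u := w) (v := v), T.dist_comm (u := x) (v := v)] at hxd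
      have e1 := ih _ (by omega) x rfl
      have h1 : T'.dist (F x) (F w) = 1 := SimpleGraph.dist_eq_one_iff_adj.2 (hadj _ _ hx.symm)
      by_cases hvx : v = x
      · subst hvx
        rw [SimpleGraph.dist_self] at hxd
        omega
      obtain ⟨y, hy, hyd⟩ := exists_adj_between hT hvx
      rw [T.dist_comm (u := x) (v := v), T.dist_comm (u := y) (v := v)] at hyd
      have e2 := ih _ (by omega) y rfl
      have h2 : T'.dist (F y) (F x) = 1 := SimpleGraph.dist_eq_one_iff_adj.2 (hadj _ _ hy.symm)
      have hyw : y ≠ w := by rintro rfl; omega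
      have b1 : Between T' (F v) (F y) (F x) := by unfold Between; omega
      have b2 := between_of_adj_of_ne hT' (hadj _ _ hy) (hadj _ _ hx.symm)
        (hinj x y w hy hx.symm hyw)
      have b3 := b1.concat hT' b2 (hadj _ _ hy).ne'
      unfold Between at b3
      omega
  exact key _ w rfl

theorem connected_induce_range (hT : T.Connected) {F : V → V'}
    (hadj : ∀ v w, T.Adj v w → T'.Adj (F v) (F w)) : (T'.induce (Set.range F)).Connected := by
  let f : T →g T'.induce (Set.range F) :=
    { toFun := fun v => ⟨F v, v, rfl⟩
      map_rel' := fun {a b} h => hadj a b h }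
  refine hT.map f ?_
  rintro ⟨_, v, rfl⟩
  exact ⟨v, rfl⟩

theorem equivariantlyIsomorphic_of_locally_injective (hT : T.IsTree) (hT' : T'.IsTree)
    (hmin' : IsMinimal ρ') {F : V → V'}
    (hadj : ∀ v w, T.Adj v w → T'.Adj (F v) (F w))
    (hinj : ∀ v w₁ w₂, T.Adj v w₁ → T.Adj v w₂ → w₁ ≠ w₂ → F w₁ ≠ F w₂)
    (hequi : ∀ g v, F (ρ g v) = ρ' g (F v)) : EquivariantlyIsomorphic ρ ρ' := by
  have hd := dist_map_eq_of_locally_injective hT hT' hadj hinj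
  -- The image is a connected invariant set, so minimality of the target makes it everything.
  have hbij : Function.Bijective F := by
    constructor
    · intro v w h
      rw [← dist_eq_zero hT, ← hd, h, SimpleGraph.dist_self]
    · rw [← Set.range_eq_univ]
      refine hmin' _ (connected_induce_range hT.connected hadj) ?_
      rintro g _ ⟨v, rfl⟩
      exact ⟨ρ g v, hequi g v⟩
  refine ⟨⟨Equiv.ofBijective F hbij, fun {a b} => ?_⟩, hequi⟩
  rw [Equiv.ofBijective_apply, Equiv.ofBijective_apply, ← SimpleGraph.dist_eq_one_iff_adj, hd,
    SimpleGraph.dist_eq_one_iff_adj]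

/-- `v` and `v'` are corresponding points of the segments from `a` to `a * s` in the orbits of the
base points. -/
def SegRel (ρ : Γ →* (T ≃g T)) (ρ' : Γ →* (T' ≃g T')) (p : V) (p' : V') (a s : Γ) (v : V)
    (v' : V') : Prop :=
  Between T (ρ a p) v (ρ (a * s) p) ∧ Between T' (ρ' a p') v' (ρ' (a * s) p') ∧
    T'.dist (ρ' a p') v' = T.dist (ρ a p) v

/-- Two actions are isomorphic if they agree on the distances between the ends of any two
segments that meet, for a family of segments covering the first tree. -/
theorem equivariantlyIsomorphic_of_dist_eq (hT : T.IsTree) (hT' : T'.IsTree)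
    (hmin' : IsMinimal ρ') (p : V) (p' : V') (S : Set Γ)
    (hv : ∀ v, ∃ a, ∃ s ∈ S, Between T (ρ a p) v (ρ (a * s) p))
    (he : ∀ v w, T.Adj v w → ∃ a, ∃ s ∈ S, Between T (ρ a p) v (ρ (a * s) p) ∧
      Between T (ρ a p) w (ρ (a * s) p))
    (hd : ∀ a c, ∀ s ∈ S, ∀ t ∈ S, ∀ v, Between T (ρ a p) v (ρ (a * s) p) →
      Between T (ρ c p) v (ρ (c * t) p) →
      T'.dist (ρ' a p') (ρ' c p') = T.dist (ρ a p) (ρ c p) ∧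
      T'.dist (ρ' a p') (ρ' (c * t) p') = T.dist (ρ a p) (ρ (c * t) p) ∧
      T'.dist (ρ' (a * s) p') (ρ' c p') = T.dist (ρ (a * s) p) (ρ c p) ∧
      T'.dist (ρ' (a * s) p') (ρ' (c * t) p') = T.dist (ρ (a * s) p) (ρ (c * t) p)) :
    EquivariantlyIsomorphic ρ ρ' := by
  have hseg : ∀ a, ∀ s ∈ S, T'.dist (ρ' a p') (ρ' (a * s) p') = T.dist (ρ a p) (ρ (a * s) p) :=
    fun a s hs => (hd a a s hs s hs _ (between_left _ _) (between_left _ _)).2.1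
  have hex : ∀ a, ∀ s ∈ S, ∀ v, Between T (ρ a p) v (ρ (a * s) p) →
      ∃ v', SegRel ρ ρ' p p' a s v v' := by
    intro a s hs v h
    obtain ⟨v', h1, h2⟩ := exists_between_dist hT' (ρ' a p') (ρ' (a * s) p')
      (m := T.dist (ρ a p) v) (by rw [hseg a s hs]; unfold Between at h; omega)
    exact ⟨v', h, h1, h2⟩
  have hdist : ∀ a c, ∀ s ∈ S, ∀ t ∈ S, ∀ v w v' w', SegRel ρ ρ' p p' a s v v' →
      SegRel ρ ρ' p p' c t w w' → Between T (ρ c p) v (ρ (c * t) p) →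
      T'.dist v' w' = T.dist v w := by
    intro a c s hs t ht v w v' w' h1 h2 h3
    obtain ⟨d1, d2, d3, d4⟩ := hd a c s hs t ht v h1.1 h3
    exact dist_eq_of_segments hT hT' h1.1 h1.2.1 (hseg a s hs) h1.2.2 h2.1 h2.2.1 (hseg c t ht)
      h2.2.2 d1 d2 d3 d4
  -- Well-definedness: two candidates for the image of `v`, taken from different segments through
  -- `v`, are at distance `d(v, v) = 0`.
  have huniq : ∀ a c, ∀ s ∈ S, ∀ t ∈ S, ∀ v v' v'', SegRel ρ ρ' p p' a s v v' →
      SegRel ρ ρ' p p' c t v v'' → v' = v'' := by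
    intro a c s hs t ht v v' v'' h1 h2
    rw [← dist_eq_zero hT', hdist a c s hs t ht v v v' v'' h1 h2 h2.1, SimpleGraph.dist_self]
  have hF : ∀ v, ∃ v', ∃ a, ∃ s ∈ S, SegRel ρ ρ' p p' a s v v' := by
    intro v
    obtain ⟨a, s, hs, h⟩ := hv v
    obtain ⟨v', h'⟩ := hex a s hs v h
    exact ⟨v', a, s, hs, h'⟩
  choose F hF using hF
  have hF' : ∀ a, ∀ s ∈ S, ∀ v, Between T (ρ a p) v (ρ (a * s) p) →
      SegRel ρ ρ' p p' a s v (F v) := by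
    intro a s hs v h
    obtain ⟨v', h'⟩ := hex a s hs v h
    obtain ⟨c, t, ht, h2⟩ := hF v
    rwa [huniq c a t ht s hs v _ _ h2 h']
  refine equivariantlyIsomorphic_of_locally_injective hT hT' hmin' (F := F) ?_ ?_ ?_
  · intro v w h
    obtain ⟨a, s, hs, h1, h2⟩ := he v w h
    rw [← SimpleGraph.dist_eq_one_iff_adj, hdist a a s hs s hs v w _ _ (hF' a s hs v h1)
      (hF' a s hs w h2) h1, SimpleGraph.dist_eq_one_iff_adj.2 h]
  -- The edges `vw₁` and `vw₂` may lie on different segments, but these meet at `v`, so the distance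
  -- between `w₁` and `w₂` is still preserved.
  · intro v w₁ w₂ h1 h2 hne heq
    obtain ⟨a, s, hs, b1, b2⟩ := he v w₁ h1
    obtain ⟨c, t, ht, b3, b4⟩ := he v w₂ h2
    apply hne
    obtain ⟨d1, d2, d3, d4⟩ := hd a c s hs t ht v b1 b3
    rw [← dist_eq_zero hT, ← dist_eq_of_segments hT hT' b2 (hF' a s hs _ b2).2.1 (hseg a s hs)
      (hF' a s hs _ b2).2.2 b4 (hF' c t ht _ b4).2.1 (hseg c t ht) (hF' c t ht _ b4).2.2
      d1 d2 d3 d4, heq, SimpleGraph.dist_self]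
  · intro g v
    obtain ⟨a, s, hs, h1, h2, h3⟩ := hF v
    have hg : SegRel ρ ρ' p p' (g * a) s (ρ g v) (ρ' g (F v)) := by
      have h1' := h1.map (ρ := ρ) g
      have h2' := h2.map (ρ := ρ') g
      rw [← mul_apply, ← mul_apply, ← mul_assoc] at h1' h2'
      exact ⟨h1', h2', by rw [mul_apply, mul_apply, dist_iso, dist_iso, h3]⟩
    obtain ⟨c, t, ht, h4⟩ := hF (ρ g v)
    exact huniq c (g * a) t ht s hs _ _ _ h4 hg

/-- The graph whose edges are those on the translates of the segments from `p` to the points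
`ρ s p` with `s ∈ S`. -/
def segmentGraph (ρ : Γ →* (T ≃g T)) (p : V) (S : Set Γ) : SimpleGraph V where
  Adj v w := T.Adj v w ∧ ∃ a, ∃ s ∈ S, Between T (ρ a p) v (ρ (a * s) p) ∧
      Between T (ρ a p) w (ρ (a * s) p)
  symm := ⟨fun _ _ h => ⟨h.1.symm, by
    obtain ⟨a, s, hs, h1, h2⟩ := h.2
    exact ⟨a, s, hs, h2, h1⟩⟩⟩
  loopless := ⟨fun _ h => h.1.ne rfl⟩

theorem segmentGraph_reachable_apply {p : V} {S : Set Γ} {x y : V}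
    (h : (segmentGraph ρ p S).Reachable x y) (g : Γ) :
    (segmentGraph ρ p S).Reachable (ρ g x) (ρ g y) := by
  let f : segmentGraph ρ p S →g segmentGraph ρ p S :=
    { toFun := ρ g
      map_rel' := by
        rintro x y ⟨h, a, s, hs, h1, h2⟩
        have h1' := h1.map (ρ := ρ) g
        have h2' := h2.map (ρ := ρ) g
        rw [← mul_apply, ← mul_apply, ← mul_assoc] at h1' h2'
        exact ⟨(ρ g).map_rel_iff.2 h, g * a, s, hs, h1', h2'⟩ }
  exact h.map f

theorem segmentGraph_reachable_segment (hT : T.IsTree) {p : V} {S : Set Γ} {s : Γ} (hs : s ∈ S) :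
    (segmentGraph ρ p S).Reachable p (ρ s p) := by
  have key : ∀ m v, Between T p v (ρ s p) → T.dist v p = m →
      (segmentGraph ρ p S).Reachable p v := by
    intro m
    induction m with
    | zero =>
      intro v _ h
      rw [dist_eq_zero hT] at h
      rw [h]
    | succ m ih =>
      intro v hv h
      have hne : p ≠ v := by
        rintro rfl
        simp at h
      obtain ⟨w, hw, hd⟩ := exists_adj_between hT hne
      have b : Between T p w v := by
        unfold Between
        rw [T.dist_comm (u := p) (v := w), T.dist_comm (u := p) (v := v),
          SimpleGraph.dist_eq_one_iff_adj.2 hw.symm, hd]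
      refine (ih w (b.trans_left hT hv) (by omega)).trans (SimpleGraph.Adj.reachable ?_)
      exact ⟨hw.symm, 1, s, hs, by simpa using b.trans_left hT hv, by simpa using hv⟩
  exact key _ _ (between_right _ _) rfl

theorem segmentGraph_connected (hT : T.IsTree) (hmin : IsMinimal ρ) (p : V) {S : Set Γ}
    (hS : Subgroup.closure S = ⊤) : (segmentGraph ρ p S).Connected := by
  have horb : ∀ g, (segmentGraph ρ p S).Reachable p (ρ g p) := by
    intro g
    have hg : g ∈ Subgroup.closure S := by rw [hS]; trivial
    induction hg using Subgroup.closure_induction with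
    | mem s hs => exact segmentGraph_reachable_segment hT hs
    | one => rw [one_apply]
    | mul a b _ _ ha hb =>
      rw [mul_apply]
      exact ha.trans (segmentGraph_reachable_apply hb a)
    | inv a _ ha =>
      have := segmentGraph_reachable_apply ha a⁻¹
      rw [inv_apply_apply] at this
      exact this.symm
  set c := (segmentGraph ρ p S).connectedComponentMk p with hc
  have hle : segmentGraph ρ p S ≤ T := fun _ _ h => h.1
  -- The component of `p` contains its whole orbit, hence is invariant; minimality applies.
  have huniv : c.supp = Set.univ := by
    refine hmin _ ?_ ?_
    · exact c.connected_toSimpleGraph.mono (SimpleGraph.comap_monotone _ hle)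
    · intro g x hx
      rw [SimpleGraph.ConnectedComponent.mem_supp_iff, hc, SimpleGraph.ConnectedComponent.eq] at *
      exact (segmentGraph_reachable_apply hx g).trans (horb g).symm
  have hreach : ∀ x, (segmentGraph ρ p S).Reachable x p := by
    intro x
    have : x ∈ c.supp := by rw [huniv]; trivial
    rwa [SimpleGraph.ConnectedComponent.mem_supp_iff, hc, SimpleGraph.ConnectedComponent.eq] at this
  have := hT.connected.nonempty
  exact ⟨fun x y => (hreach x).trans (hreach y).symm⟩

/-- Every edge of a tree is a bridge, so a walk from `v` to `w` in the connected `segmentGraph` must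
use the edge `vw` itself. -/
theorem exists_segment_of_adj (hT : T.IsTree) (hmin : IsMinimal ρ) (p : V) {S : Set Γ}
    (hS : Subgroup.closure S = ⊤) {v w : V} (h : T.Adj v w) :
    ∃ a, ∃ s ∈ S, Between T (ρ a p) v (ρ (a * s) p) ∧ Between T (ρ a p) w (ρ (a * s) p) := by
  obtain ⟨q⟩ := (segmentGraph_connected hT hmin p hS).preconnected v w
  have hle : segmentGraph ρ p S ≤ T := fun _ _ h => h.1
  have hmem : s(v, w) ∈ (q.mapLe hle).edges :=
    SimpleGraph.isBridge_iff_forall_walk_mem_edges.1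
      (SimpleGraph.isAcyclic_iff_forall_isBridge.1 hT.isAcyclic h) _
  rw [SimpleGraph.Walk.edges_mapLe_eq_edges] at hmem
  exact (q.adj_of_mem_edges hmem).2

theorem exists_mem_segment (hT : T.IsTree) (hmin : IsMinimal ρ) (p : V) {S : Set Γ}
    (h1 : 1 ∈ S) (hS : Subgroup.closure S = ⊤) (v : V) :
    ∃ a, ∃ s ∈ S, Between T (ρ a p) v (ρ (a * s) p) := by
  by_cases hv : p = v
  · exact ⟨1, 1, h1, by simp [hv, Between]⟩
  · obtain ⟨w, hw, -⟩ := exists_adj_between hT hv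
    obtain ⟨a, s, hs, h, -⟩ := exists_segment_of_adj hT hmin p hS hw
    exact ⟨a, s, hs, h⟩

theorem finite_segment (hT : T.IsTree) (a b : V) : {v | Between T a v b}.Finite := by
  obtain ⟨q⟩ := hT.connected.preconnected a b
  exact q.support.finite_toSet.subset fun v hv => mem_support_of_between hT hv q

end Extension

/-! ### From translation lengths to displacements of a base vertex -/

section BasedLength

variable {Γ : Type w} [Group Γ] {V : Type u} {T : SimpleGraph V} {ρ : Γ →* (T ≃g T)}
  {V' : Type v} {T' : SimpleGraph V'} {ρ' : Γ →* (T' ≃g T')}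

theorem elementLength_one (hT : T.IsTree) (ρ : Γ →* (T ≃g T)) : elementLength ρ 1 = 0 := by
  have := hT.connected.nonempty
  simp [elementLength]

theorem ne_one_of_elementLength_pos (hT : T.IsTree) {g : Γ} (h : 0 < elementLength ρ g) :
    g ≠ 1 := by
  rintro rfl
  rw [elementLength_one hT] at h
  exact h.false

theorem dist_apply_apply (g h : Γ) (x : V) :
    T.dist (ρ g x) (ρ h x) = T.dist x (ρ (g⁻¹ * h) x) := by
  rw [mul_apply, ← dist_iso (ρ g⁻¹), inv_apply_apply]

theorem IsBridge.mul_ne_one (hT : T.IsTree) (hfree : IsFree ρ) {g h : Γ} (hg : g ≠ 1)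
    (hh : h ≠ 1) {a b : V} (hb : IsBridge ρ g h a b) : g * h ≠ 1 := by
  refine ne_one_of_elementLength_pos hT (ρ := ρ) ?_
  rw [hb.elementLength_mul hT hfree hg hh]
  have := elementLength_pos hT hfree hg
  omega

/-- The axis of `gh` enters `a` from the bridge and leaves towards `ga`. A vertex `w` behind `a` on
the axis of `g` would be a third branch. -/
theorem IsBridge.not_mem_axis_mul (hT : T.IsTree) (hfree : IsFree ρ) {g h : Γ} (hg : g ≠ 1)
    (hh : h ≠ 1) {a b w : V} (hb : IsBridge ρ g h a b) (hw : w ∈ axis ρ g) (hne : w ≠ a)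
    (hwg : Between T w a (ρ g a)) : w ∉ axis ρ (g * h) := fun hw' =>
  axis_not_branching hT hfree (hb.mul_ne_one hT hfree hg hh)
    (hb.left_mem_axis_mul hT hfree hg hh) hw' hne
    (hwg.concat' hT (hb.right_chain hT hfree hh).1 (hfree.apply_ne hg a).symm)
    ((hb.left_proj w hw).symm.concat' hT (hb.left_chain hT hfree hh) hb.ne)

/-- Three elements whose axes have only one vertex in common if the axes of `g` and `h` are
disjoint. -/
def tripod (g h : Γ) : Set Γ := {g, g * h, g⁻¹ * h}

theorem tripod_finite (g h : Γ) : (tripod g h).Finite := by simp [tripod]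

theorem IsBridge.ne_one_of_mem_tripod (hT : T.IsTree) (hfree : IsFree ρ) {g h : Γ} (hg : g ≠ 1)
    (hh : h ≠ 1) {a b : V} (hb : IsBridge ρ g h a b) {s : Γ} (hs : s ∈ tripod g h) : s ≠ 1 := by
  rcases hs with rfl | rfl | rfl
  · exact hg
  · exact hb.mul_ne_one hT hfree hg hh
  · exact hb.inv_left.mul_ne_one hT hfree (inv_ne_one.2 hg) hh

theorem IsBridge.mem_axis_of_mem_tripod (hT : T.IsTree) (hfree : IsFree ρ) {g h : Γ}
    (hg : g ≠ 1) (hh : h ≠ 1) {a b : V} (hb : IsBridge ρ g h a b) {s : Γ} (hs : s ∈ tripod g h) :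
    a ∈ axis ρ s := by
  rcases hs with rfl | rfl | rfl
  · exact hb.left_mem
  · exact hb.left_mem_axis_mul hT hfree hg hh
  · exact hb.inv_left.left_mem_axis_mul hT hfree (inv_ne_one.2 hg) hh

theorem IsBridge.exists_tripod_proj (hT : T.IsTree) (hfree : IsFree ρ) {g h : Γ} (hg : g ≠ 1)
    (hh : h ≠ 1) {a b : V} (hb : IsBridge ρ g h a b) {q : V} (hq : q ≠ a) :
    ∃ s ∈ tripod g h, ∀ y ∈ axis ρ s, Between T q a y := by
  by_contra! hcon
  obtain ⟨w, hw, hwq⟩ := exists_adj_between hT hq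
  have hmem : ∀ s ∈ tripod g h, w ∈ axis ρ s := by
    intro s hs
    by_contra hws
    obtain ⟨y, hy, hn⟩ := hcon s hs
    exact hn (between_of_adj_not_mem hT (axis_convex hT ρ s)
      (hb.mem_axis_of_mem_tripod hT hfree hg hh hs) hw hwq hws y hy)
  have h1 := hmem g (by simp [tripod])
  -- The neighbour `w` lies on one side of `a` on the axis of `g`; the axis of `g⁻¹h` avoids the
  -- forward side and that of `gh` the backward side.
  rcases (between_of_mem_axis hT hfree hg hb.left_mem).or hT w with h2 | h2
  · refine hb.inv_left.not_mem_axis_mul hT hfree (inv_ne_one.2 hg) hh ?_ hw.ne' h2.symm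
      (hmem _ (by simp [tripod]))
    rwa [axis_inv]
  · exact hb.not_mem_axis_mul hT hfree hg hh h1 hw.ne' h2.symm (hmem _ (by simp [tripod]))

/-- Choose `s` whose axis turns away from `ka` at `a`, and `t` whose axis turns away from `k⁻¹a` at
`a`. Then `[a, ka]` is the bridge between the axes of `s` and `ktk⁻¹`. -/
theorem IsBridge.exists_elementLength_eq (hT : T.IsTree) (hfree : IsFree ρ) {g h : Γ}
    (hg : g ≠ 1) (hh : h ≠ 1) {a b : V} (hb : IsBridge ρ g h a b) {k : Γ} (hk : k ≠ 1) :
    ∃ s ∈ tripod g h, ∃ t ∈ tripod g h, elementLength ρ (s * (k * t * k⁻¹)) =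
      elementLength ρ s + elementLength ρ t + 2 * T.dist a (ρ k a) := by
  obtain ⟨s, hs, h1⟩ := hb.exists_tripod_proj hT hfree hg hh (hfree.apply_ne hk a)
  obtain ⟨t, ht, h2⟩ := hb.exists_tripod_proj hT hfree hg hh
    (hfree.apply_ne (inv_ne_one.2 hk) a)
  refine ⟨s, hs, t, ht, ?_⟩
  have hbr : IsBridge ρ s (k * t * k⁻¹) a (ρ k a) := by
    refine ⟨(hfree.apply_ne hk a).symm, hb.mem_axis_of_mem_tripod hT hfree hg hh hs,
      apply_mem_axis (hb.mem_axis_of_mem_tripod hT hfree hg hh ht), h1, fun y hy => ?_⟩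
    have h3 := apply_mem_axis (h := k⁻¹) hy
    rw [inv_inv, ← mul_assoc, ← mul_assoc, inv_mul_cancel, one_mul, inv_mul_cancel_right] at h3
    have h4 := (h2 _ h3).map (ρ := ρ) k
    rwa [apply_inv_apply, apply_inv_apply] at h4
  rw [hbr.elementLength_mul hT hfree (hb.ne_one_of_mem_tripod hT hfree hg hh hs),
    elementLength_conj]
  rw [Ne, conj_eq_one_iff]
  exact hb.ne_one_of_mem_tripod hT hfree hg hh ht

theorem IsBridge.elementLength_le_of_mem_tripod (hT : T.IsTree) (hfree : IsFree ρ) {g h : Γ}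
    (hg : g ≠ 1) (hh : h ≠ 1) {a b : V} (hb : IsBridge ρ g h a b) (k : Γ) {s t : Γ}
    (hs : s ∈ tripod g h) (ht : t ∈ tripod g h) : elementLength ρ (s * (k * t * k⁻¹)) ≤
      elementLength ρ s + elementLength ρ t + 2 * T.dist a (ρ k a) := by
  rw [← elementLength_conj ρ t k]
  exact elementLength_mul_le hT ρ (hb.mem_axis_of_mem_tripod hT hfree hg hh hs)
    (apply_mem_axis (hb.mem_axis_of_mem_tripod hT hfree hg hh ht))

/-- The length function determines the displacement of the end of a bridge. -/
theorem IsBridge.dist_eq (hT : T.IsTree) (hfree : IsFree ρ) (hT' : T'.IsTree)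
    (hfree' : IsFree ρ') {g h : Γ} (hg : g ≠ 1) (hh : h ≠ 1) {a b : V} {a' b' : V'}
    (hb : IsBridge ρ g h a b) (hb' : IsBridge ρ' g h a' b') (k : Γ)
    (h1 : ∀ s ∈ tripod g h, elementLength ρ' s = elementLength ρ s)
    (h2 : ∀ s ∈ tripod g h, ∀ t ∈ tripod g h,
      elementLength ρ' (s * (k * t * k⁻¹)) = elementLength ρ (s * (k * t * k⁻¹))) :
    T'.dist a' (ρ' k a') = T.dist a (ρ k a) := by
  by_cases hk : k = 1
  · subst hk; simp
  -- In both trees `2 d(a, ka)` is the maximum over `s`, `t` in the tripod of `ℓ(s·ktk⁻¹) - ℓ(s) -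
  -- ℓ(t)`.
  apply le_antisymm
  · obtain ⟨s, hs, t, ht, e⟩ := hb'.exists_elementLength_eq hT' hfree' hg hh hk
    have := hb.elementLength_le_of_mem_tripod hT hfree hg hh k hs ht
    rw [h1 s hs, h1 t ht, h2 s hs t ht] at e
    omega
  · obtain ⟨s, hs, t, ht, e⟩ := hb.exists_elementLength_eq hT hfree hg hh hk
    have := hb'.elementLength_le_of_mem_tripod hT' hfree' hg hh k hs ht
    rw [h1 s hs, h1 t ht, h2 s hs t ht] at this
    omega

/-- Two elements without common powers give rise to elements with disjoint axes. -/
theorem exists_disjoint_axis (hT : T.IsTree) (hfree : IsFree ρ) {x y : Γ} (hx : x ≠ 1)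
    (hy : y ≠ 1) (hxy : ∀ m : ℕ, m ≠ 0 → ∀ j : ℤ, x ^ m ≠ y ^ j) :
    ∃ g h : Γ, g ≠ 1 ∧ h ≠ 1 ∧ Disjoint (axis ρ g) (axis ρ h) := by
  by_cases hd : Disjoint (axis ρ x) (axis ρ y)
  · exact ⟨x, y, hx, hy, hd⟩
  obtain ⟨p, hpx, hpy⟩ := Set.not_disjoint_iff.1 hd
  -- `k` translates by `ℓ(x)ℓ(y)` along the axis of `x`. If the axes of `y` and `kyk⁻¹` met, Helly
  -- would give `m` with `m` and `k⁻¹m` on both axes of `x` and `y`; then `y` to the power `±ℓ(x)`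
  -- also takes `k⁻¹m` to `m`, and freeness equates the two powers.
  set k := x ^ elementLength ρ y with hk
  refine ⟨y, k * y * k⁻¹, hy, by rwa [Ne, conj_eq_one_iff], ?_⟩
  by_contra hn
  obtain ⟨z, hz1, hz2⟩ := Set.not_disjoint_iff.1 hn
  obtain ⟨m, ⟨hm1, hm2⟩, hm3⟩ := (axis_convex hT ρ x).helly hT (axis_convex hT ρ y)
    (axis_convex hT ρ (k * y * k⁻¹)) ⟨p, hpx, hpy⟩ ⟨z, hz1, hz2⟩
    ⟨ρ k p, apply_pow_mem_axis hpx _, apply_mem_axis hpy⟩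
  have h1 : ρ k⁻¹ m ∈ axis ρ y := by
    have := apply_mem_axis (h := k⁻¹) hm3
    rwa [inv_inv, ← mul_assoc, ← mul_assoc, inv_mul_cancel, one_mul, inv_mul_cancel_right] at this
  have h2 : T.dist (ρ k⁻¹ m) m = elementLength ρ x * elementLength ρ y := by
    rw [dist_inv_apply, hk, dist_pow_apply hT hfree hx hm1, mul_comm]
  have hyp := elementLength_pos hT hfree hy
  have hxp := elementLength_pos hT hfree hx
  rcases eq_pow_apply_or hT hfree hy h1 hm2 hxp.ne' h2 with h3 | h3
  · refine hxy _ hyp.ne' (elementLength ρ x) (hfree.eq_of_apply_eq (x := ρ k⁻¹ m) ?_)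
    rw [← hk, apply_inv_apply, zpow_natCast]
    exact h3
  · refine hxy _ hyp.ne' (-elementLength ρ x) (hfree.eq_of_apply_eq (x := ρ k⁻¹ m) ?_)
    rw [← hk, apply_inv_apply, zpow_neg, zpow_natCast, ← inv_pow]
    exact h3

/-- A free minimal action of a finitely generated group is determined by finitely many values of
a based length function. -/
theorem exists_finite_based_length_determines (hT : T.IsTree) (hfree : IsFree ρ)
    (hmin : IsMinimal ρ) (p : V) {S : Set Γ} (hS : S.Finite) (h1 : 1 ∈ S)
    (hcl : Subgroup.closure S = ⊤) : ∃ K : Set Γ, K.Finite ∧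
      ∀ (V' : Type v) (T' : SimpleGraph V') (ρ' : Γ →* (T' ≃g T')) (p' : V'),
        T'.IsTree → IsMinimal ρ' → (∀ k ∈ K, T'.dist p' (ρ' k p') = T.dist p (ρ k p)) →
        EquivariantlyIsomorphic ρ ρ' := by
  -- The relative positions `a⁻¹c` of two meeting segments. By freeness each pair of vertices `x`,
  -- `y` contributes at most one element.
  set K₀ : Set Γ := ⋃ s ∈ S, ⋃ t ∈ S, ⋃ x ∈ {x | Between T p x (ρ s p)},
    ⋃ y ∈ {y | Between T p y (ρ t p)}, {g | ρ g y = x} with hK₀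
  have hfin : K₀.Finite := by
    refine hS.biUnion fun s _ => hS.biUnion fun t _ => (finite_segment hT _ _).biUnion
      fun x _ => (finite_segment hT _ _).biUnion fun y _ => Set.Subsingleton.finite ?_
    intro g hg h hh
    exact hfree.eq_of_apply_eq (hg.trans (Eq.symm hh))
  refine ⟨(fun q : Γ × Γ × Γ => q.1⁻¹ * q.2.1 * q.2.2) '' (S ×ˢ K₀ ×ˢ S),
    (hS.prod (hfin.prod hS)).image _, ?_⟩
  intro V' T' ρ' p' hT' hmin' hK
  refine equivariantlyIsomorphic_of_dist_eq hT hT' hmin' p p' S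
    (exists_mem_segment hT hmin p h1 hcl) (fun _ _ => exists_segment_of_adj hT hmin p hcl) ?_
  intro a c s hs t ht x hx1 hx2
  have hg : a⁻¹ * c ∈ K₀ := by
    simp only [hK₀, Set.mem_iUnion]
    have b1 := hx1.map (ρ := ρ) a⁻¹
    have b2 := hx2.map (ρ := ρ) c⁻¹
    rw [inv_apply_apply, ← mul_apply, inv_mul_cancel_left] at b1 b2
    exact ⟨s, hs, t, ht, _, b1, _, b2, by simp only [Set.mem_ofPred_eq, mul_apply, apply_inv_apply]⟩
  have key : ∀ s₁ ∈ S, ∀ t₁ ∈ S, T'.dist (ρ' (a * s₁) p') (ρ' (c * t₁) p') =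
      T.dist (ρ (a * s₁) p) (ρ (c * t₁) p) := by
    intro s₁ hs₁ t₁ ht₁
    rw [dist_apply_apply, dist_apply_apply]
    refine hK _ ⟨(s₁, a⁻¹ * c, t₁), ⟨hs₁, hg, ht₁⟩, ?_⟩
    simp [mul_assoc]
  refine ⟨?_, ?_, ?_, key s hs t ht⟩
  · simpa using key 1 h1 1 h1
  · simpa using key 1 h1 t ht
  · simpa using key s hs 1 h1

theorem translationLength_mk (ρ : Γ →* (T ≃g T)) (g : Γ) :
    translationLength ρ (ConjClasses.mk g) = elementLength ρ g := rfl

theorem exists_finite_isDeterminedBy_of_based (hT : T.IsTree) (hfree : IsFree ρ)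
    (hmin : IsMinimal ρ) [Group.FG Γ] (p : V)
    (h : ∀ K : Set Γ, K.Finite → ∃ C : Set (ConjClasses Γ), C.Finite ∧
      ∀ (V' : Type v) (T' : SimpleGraph V') (ρ' : Γ →* (T' ≃g T')), T'.IsTree → IsFree ρ' →
        (∀ c ∈ C, translationLength ρ' c = translationLength ρ c) →
        ∃ p', ∀ k ∈ K, T'.dist p' (ρ' k p') = T.dist p (ρ k p)) :
    ∃ C : Set (ConjClasses Γ), C.Finite ∧ IsDeterminedBy.{u, v} ρ C := by
  obtain ⟨S, hS, hfin⟩ := Group.fg_iff.1 ‹Group.FG Γ›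
  obtain ⟨K, hK, hdet⟩ := exists_finite_based_length_determines.{u, v} hT hfree hmin p
    (hfin.insert 1) (Set.mem_insert _ _) (top_le_iff.1 (hS.ge.trans
      (Subgroup.closure_mono (Set.subset_insert _ _))))
  obtain ⟨C, hC, hCdet⟩ := h K hK
  refine ⟨C, hC, fun V' T' ρ' hT' hfree' hmin' hc => ?_⟩
  obtain ⟨p', hp'⟩ := hCdet V' T' ρ' hT' hfree' hc
  exact hdet V' T' ρ' p' hT' hmin' hp'

theorem exists_finite_isDeterminedBy_of_forall_pow_ne (hT : T.IsTree) (hfree : IsFree ρ)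
    (hmin : IsMinimal ρ) [Group.FG Γ] {x y : Γ} (hx : x ≠ 1) (hy : y ≠ 1)
    (hxy : ∀ m : ℕ, m ≠ 0 → ∀ j : ℤ, x ^ m ≠ y ^ j) :
    ∃ C : Set (ConjClasses Γ), C.Finite ∧ IsDeterminedBy.{u, v} ρ C := by
  obtain ⟨g, h, hg, hh, hd⟩ := exists_disjoint_axis hT hfree hx hy hxy
  obtain ⟨a, b, hb⟩ := exists_isBridge hT hd
  refine exists_finite_isDeterminedBy_of_based hT hfree hmin a fun K hK => ?_
  have hU := tripod_finite g h
  refine ⟨ConjClasses.mk '' (insert h (tripod g h)) ∪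
    (fun q : Γ × Γ × Γ => ConjClasses.mk (q.1 * (q.2.1 * q.2.2 * q.2.1⁻¹))) ''
      (tripod g h ×ˢ K ×ˢ tripod g h),
    ((hU.insert h).image _).union ((hU.prod (hK.prod hU)).image _), ?_⟩
  intro V' T' ρ' hT' hfree' hC
  have h1 : ∀ s ∈ insert h (tripod g h), elementLength ρ' s = elementLength ρ s :=
    fun s hs => hC _ (Or.inl ⟨s, hs, rfl⟩)
  have hd' : Disjoint (axis ρ' g) (axis ρ' h) := by
    rw [disjoint_axis_iff hT hfree hg hh] at hd
    rw [disjoint_axis_iff hT' hfree' hg hh, h1 g (by simp [tripod]), h1 h (by simp),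
      h1 (g * h) (by simp [tripod])]
    exact hd
  obtain ⟨a', b', hb'⟩ := exists_isBridge hT' hd'
  refine ⟨a', fun k hk => ?_⟩
  exact hb.dist_eq hT hfree hT' hfree' hg hh hb' k (fun s hs => h1 s (Or.inr hs))
    fun s hs t ht => hC _ (Or.inr ⟨(s, k, t), ⟨hs, hk, ht⟩, rfl⟩)

theorem exists_finite_isDeterminedBy_of_zpow (hT : T.IsTree) (hfree : IsFree ρ)
    (hmin : IsMinimal ρ) [Group.FG Γ] {x : Γ} (hx : x ≠ 1) (hgen : ∀ k : Γ, ∃ m : ℤ, k = x ^ m) :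
    ∃ C : Set (ConjClasses Γ), C.Finite ∧ IsDeterminedBy.{u, v} ρ C := by
  obtain ⟨p, hp⟩ := axis_nonempty hT ρ x
  refine exists_finite_isDeterminedBy_of_based hT hfree hmin p fun K _ =>
    ⟨{ConjClasses.mk x}, Set.finite_singleton _, fun V' T' ρ' hT' hfree' hC => ?_⟩
  obtain ⟨p', hp'⟩ := axis_nonempty hT' ρ' x
  refine ⟨p', fun k _ => ?_⟩
  obtain ⟨m, rfl⟩ := hgen k
  have hl : elementLength ρ' x = elementLength ρ x := hC _ rfl
  rw [dist_zpow_apply hT hfree hx hp, dist_zpow_apply hT' hfree' hx hp', hl]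

theorem exists_finite_isDeterminedBy_of_subsingleton (hT : T.IsTree) (hfree : IsFree ρ)
    (hmin : IsMinimal ρ) [Subsingleton Γ] :
    ∃ C : Set (ConjClasses Γ), C.Finite ∧ IsDeterminedBy.{u, v} ρ C := by
  obtain ⟨p⟩ := hT.connected.nonempty
  refine exists_finite_isDeterminedBy_of_based hT hfree hmin p fun K _ =>
    ⟨∅, Set.finite_empty, fun V' T' ρ' hT' _ _ => ?_⟩
  obtain ⟨p'⟩ := hT'.connected.nonempty
  refine ⟨p', fun k _ => ?_⟩
  rw [Subsingleton.elim k 1]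
  simp

end BasedLength

/-! ### Finite determination in every rank -/

theorem freeGroup_of_pow_ne_zpow {α : Type u} {i j : α} (hij : i ≠ j) {m : ℕ} (hm : m ≠ 0)
    (l : ℤ) : FreeGroup.of i ^ m ≠ FreeGroup.of j ^ l := by
  classical
  intro h
  -- Compare exponent sums of the generator `i`.
  have h' := congrArg (FreeGroup.lift fun k => if k = i then Multiplicative.ofAdd (1 : ℤ) else 1) h
  rw [map_pow, map_zpow, FreeGroup.lift_apply_of, FreeGroup.lift_apply_of, if_pos rfl,
    if_neg hij.symm, one_zpow, ← ofAdd_nsmul, ofAdd_eq_one] at h'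
  simp at h'
  exact hm h'

theorem exists_finite_isDeterminedBy (n : ℕ) {V : Type u} {T : SimpleGraph V} (hT : T.IsTree)
    {ρ : FreeGroup (Fin n) →* (T ≃g T)} (hfree : IsFree ρ) (hmin : IsMinimal ρ) :
    ∃ C : Set (ConjClasses (FreeGroup (Fin n))), C.Finite ∧ IsDeterminedBy.{u, v} ρ C := by
  match n with
  | 0 => exact exists_finite_isDeterminedBy_of_subsingleton hT hfree hmin
  | 1 =>
    refine exists_finite_isDeterminedBy_of_zpow hT hfree hmin (FreeGroup.of_ne_one 0) fun k => ?_
    have hk : k ∈ Subgroup.closure (Set.range (FreeGroup.of : Fin 1 → FreeGroup (Fin 1))) := by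
      rw [FreeGroup.closure_range_of]; trivial
    rw [Set.range_unique, Subgroup.mem_closure_singleton] at hk
    obtain ⟨m, hm⟩ := hk
    exact ⟨m, hm.symm⟩
  | n + 2 =>
    exact exists_finite_isDeterminedBy_of_forall_pow_ne hT hfree hmin (FreeGroup.of_ne_one 0)
      (FreeGroup.of_ne_one 1) fun m hm j => freeGroup_of_pow_ne_zpow (by simp) hm j

/-! ### Vertex-transitive actions and elements of length at most two -/

section Star

variable {Γ : Type w} [Group Γ] {V : Type u} {T : SimpleGraph V} {ρ : Γ →* (T ≃g T)}
  {V' : Type v} {T' : SimpleGraph V'} {ρ' : Γ →* (T' ≃g T')}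

/-- The group elements that move `p` to a neighbour. -/
def star (ρ : Γ →* (T ≃g T)) (p : V) : Set Γ :=
  {s | T.Adj p (ρ s p)}

theorem inv_mem_star {p : V} {s : Γ} (hs : s ∈ star ρ p) : s⁻¹ ∈ star ρ p := by
  change T.Adj _ _ at hs ⊢
  rw [← SimpleGraph.dist_eq_one_iff_adj] at *
  rw [dist_apply_inv, hs]

theorem ne_one_of_mem_star {p : V} {s : Γ} (hs : s ∈ star ρ p) : s ≠ 1 := by
  rintro rfl
  change T.Adj _ _ at hs
  rw [one_apply] at hs
  exact hs.ne rfl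

theorem mul_self_ne_one_of_mem_star (hfree : IsFree ρ) {p : V} {s : Γ} (hs : s ∈ star ρ p) :
    s * s ≠ 1 := by
  intro h
  refine hfree.not_adj_swap hs ?_
  rw [← mul_apply, h, one_apply]

theorem dist_of_mem_star {p : V} {s : Γ} (hs : s ∈ star ρ p) : T.dist p (ρ s p) = 1 :=
  SimpleGraph.dist_eq_one_iff_adj.2 hs

theorem elementLength_of_mem_star (hT : T.IsTree) (hfree : IsFree ρ) {p : V} {s : Γ}
    (hs : s ∈ star ρ p) : elementLength ρ s = 1 := by
  have h1 := elementLength_pos hT hfree (ne_one_of_mem_star hs)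
  have h2 := elementLength_le ρ s p
  rw [dist_of_mem_star hs] at h2
  omega

theorem between_of_mem_star (hT : T.IsTree) {p : V} {s t : Γ} (hs : s ∈ star ρ p)
    (ht : t ∈ star ρ p) (hst : s * t ≠ 1) (hfree : IsFree ρ) :
    Between T p (ρ s p) (ρ (s * t) p) := by
  have h := (between_of_adj_of_ne hT (inv_mem_star hs) ht ?_).map (ρ := ρ) s
  · rwa [apply_inv_apply, ← mul_apply] at h
  · intro h
    refine hst (hfree.eq_of_apply_eq (x := p) ?_)
    rw [mul_apply, ← h, apply_inv_apply, one_apply]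

theorem dist_mul_of_mem_star (hT : T.IsTree) (hfree : IsFree ρ) {p : V} {s t : Γ}
    (hs : s ∈ star ρ p) (ht : t ∈ star ρ p) (hst : s * t ≠ 1) :
    T.dist p (ρ (s * t) p) = 2 := by
  have h := between_of_mem_star hT hs ht hst hfree
  unfold Between at h
  rw [← h, dist_of_mem_star hs, mul_apply, dist_iso, dist_of_mem_star ht]

theorem elementLength_mul_of_mem_star (hT : T.IsTree) (hfree : IsFree ρ) {p : V} {s t : Γ}
    (hs : s ∈ star ρ p) (ht : t ∈ star ρ p) (hst : s * t ≠ 1) :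
    elementLength ρ (s * t) = 2 := by
  obtain ⟨r, hr⟩ := exists_dist_eq_add hT hfree hst p
  have := elementLength_pos hT hfree hst
  rw [dist_mul_of_mem_star hT hfree hs ht hst] at hr
  omega

theorem eq_of_isConj_of_mem_star (hT : T.IsTree) (hfree : IsFree ρ) {p : V} {s t : Γ}
    (hs : s ∈ star ρ p) (ht : t ∈ star ρ p) (hst : IsConj s t) : s = t := by
  obtain ⟨h, rfl⟩ := isConj_iff.1 hst
  set t := h * s * h⁻¹ with ht_def
  have hs1 : p ∈ axis ρ s := by
    change T.dist _ _ = _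
    rw [dist_of_mem_star hs, elementLength_of_mem_star hT hfree hs]
  have ht1 : p ∈ axis ρ t := by
    change T.dist _ _ = _
    rw [dist_of_mem_star ht, elementLength_of_mem_star hT hfree ht]
  -- Both `p` and `hp` lie on the axis of `t`. As `t` has length one, `h` is a power of `t`.
  have hcomm : Commute h t := by
    by_cases hd : T.dist p (ρ h p) = 0
    · have : h = 1 := hfree.eq_of_apply_eq (x := p) (by
        rw [one_apply, ← (dist_eq_zero hT).1 hd])
      rw [this]
      exact Commute.one_left t
    · rcases eq_pow_apply_or hT hfree (ne_one_of_mem_star ht) ht1 (apply_mem_axis hs1) hd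
        (by rw [elementLength_of_mem_star hT hfree ht, mul_one]) with e | e
      · rw [hfree.eq_of_apply_eq e]
        exact (Commute.refl t).pow_left _
      · rw [hfree.eq_of_apply_eq e]
        exact (Commute.refl t).inv_left.pow_left _
  have e1 : h * s = h * t := by rw [hcomm.eq, ht_def]; group
  exact mul_left_cancel e1

theorem eq_and_eq_of_mul_eq (hT : T.IsTree) (hfree : IsFree ρ) {p : V} {s t s' t' : Γ}
    (hs : s ∈ star ρ p) (ht : t ∈ star ρ p) (hs' : s' ∈ star ρ p) (ht' : t' ∈ star ρ p)
    (hst : s * t ≠ 1) (h : s * t = s' * t') : s = s' ∧ t = t' := by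
  have e : s = s' := by
    refine hfree.eq_of_apply_eq (x := p) (adj_dist_unique hT hs hs' (a := ρ (s * t) p) ?_ ?_)
    · rw [dist_mul_of_mem_star hT hfree hs ht hst, mul_apply, dist_iso, dist_of_mem_star ht]
    · rw [dist_mul_of_mem_star hT hfree hs ht hst, h, mul_apply, dist_iso, dist_of_mem_star ht']
  subst e
  exact ⟨rfl, mul_left_cancel h⟩

theorem eq_zpow_apply_of_even_dist (hT : T.IsTree) (hfree : IsFree ρ) {k : Γ} (hk : k ≠ 1)
    (hl : elementLength ρ k = 2) {x y : V} (hx : x ∈ axis ρ k) (hy : y ∈ axis ρ k)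
    (hd : Even (T.dist x y)) : ∃ m : ℤ, y = ρ (k ^ m) x := by
  obtain ⟨m, hm⟩ := hd
  by_cases h0 : m = 0
  · refine ⟨0, ?_⟩
    rw [zpow_zero, one_apply, (dist_eq_zero hT).1 (show T.dist x y = 0 by omega)]
  · rcases eq_pow_apply_or hT hfree hk hx hy h0 (by rw [hl]; omega) with e | e
    · exact ⟨m, by rw [zpow_natCast]; exact e⟩
    · exact ⟨-m, by rw [zpow_neg, zpow_natCast, ← inv_pow]; exact e⟩

/-- The axis of `s't'` has two orbits of vertices under its powers, those of `p` and `s'p`. As `hp`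
lies on it, `h` is a power of `s't'`, or such a power times `s'`, according to the parity of `d(p,
hp)`; the second case swaps the factors. -/
theorem eq_or_eq_swap_of_isConj (hT : T.IsTree) (hfree : IsFree ρ) {p : V} {s t s' t' : Γ}
    (hs : s ∈ star ρ p) (ht : t ∈ star ρ p) (hs' : s' ∈ star ρ p) (ht' : t' ∈ star ρ p)
    (hst : s * t ≠ 1) (hst' : s' * t' ≠ 1) (hc : IsConj (s * t) (s' * t')) :
    s = s' ∧ t = t' ∨ s = t' ∧ t = s' := by
  obtain ⟨h, hh⟩ := isConj_iff.1 hc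
  have hp1 : p ∈ axis ρ (s * t) := by
    change T.dist _ _ = _
    rw [dist_mul_of_mem_star hT hfree hs ht hst, elementLength_mul_of_mem_star hT hfree hs ht hst]
  have hl := elementLength_mul_of_mem_star hT hfree hs' ht' hst'
  have hp2 : p ∈ axis ρ (s' * t') := by
    change T.dist _ _ = _
    rw [dist_mul_of_mem_star hT hfree hs' ht' hst', hl]
  have hp3 : ρ h p ∈ axis ρ (s' * t') := hh ▸ apply_mem_axis hp1
  have hp4 : ρ s' p ∈ axis ρ (s' * t') :=
    axis_convex hT ρ _ p hp2 _ (apply_self_mem_axis hp2) _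
      (between_of_mem_star hT hs' ht' hst' hfree)
  rcases Nat.even_or_odd (T.dist p (ρ h p)) with hev | hodd
  · obtain ⟨m, hm⟩ := eq_zpow_apply_of_even_dist hT hfree hst' hl hp2 hp3 hev
    have e := hfree.eq_of_apply_eq hm
    left
    refine eq_and_eq_of_mul_eq hT hfree hs ht hs' ht' hst ?_
    have e1 : h * (s * t) = h * (s' * t') := by
      rw [e, ((Commute.refl (s' * t')).zpow_left m).eq, ← e, ← hh]; group
    exact mul_left_cancel e1
  · have hev : Even (T.dist (ρ s' p) (ρ h p)) := by
      by_cases hb : Between T (ρ s' p) p (ρ h p)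
      · unfold Between at hb
        rw [← hb, T.dist_comm, dist_of_mem_star hs', add_comm]
        exact hodd.add_one
      · have := dist_of_adj_of_not_between hT hs' hb
        rw [← this] at hodd
        rcases Nat.even_or_odd (T.dist (ρ s' p) (ρ h p)) with h1 | h1
        · exact h1
        · exact absurd hodd (Nat.not_odd_iff_even.2 h1.add_one)
    obtain ⟨m, hm⟩ := eq_zpow_apply_of_even_dist hT hfree hst' hl hp4 hp3 hev
    rw [← mul_apply] at hm
    have e := hfree.eq_of_apply_eq hm
    right
    refine eq_and_eq_of_mul_eq hT hfree hs ht ht' hs' hst ?_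
    have e1 : h * (s * t) = h * (t' * s') := by
      calc h * (s * t) = (s' * t') * h := by rw [← hh]; group
        _ = (s' * t') ^ m * (s' * t') * s' := by
          rw [e, ← mul_assoc, ((Commute.refl (s' * t')).zpow_left m).eq]
        _ = h * (t' * s') := by rw [e]; group
    exact mul_left_cancel e1

theorem exists_mul_of_dist_eq_two (hT : T.IsTree) (htrans : ∀ x y : V, ∃ g, ρ g x = y) {p : V}
    {k : Γ} (hk : T.dist p (ρ k p) = 2) :
    ∃ s ∈ star ρ p, ∃ t ∈ star ρ p, k = s * t := by
  have hne : ρ k p ≠ p := by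
    intro h
    rw [h, SimpleGraph.dist_self] at hk
    omega
  obtain ⟨w, hw, hd⟩ := exists_adj_between hT hne
  obtain ⟨s, rfl⟩ := htrans p w
  refine ⟨s, hw, s⁻¹ * k, ?_, by group⟩
  change T.Adj _ _
  rw [← SimpleGraph.dist_eq_one_iff_adj, ← dist_apply_apply]
  omega

theorem exists_conj_star (hT : T.IsTree) (hfree : IsFree ρ)
    (htrans : ∀ x y : V, ∃ g, ρ g x = y) (p : V) {g : Γ} (hg : g ≠ 1)
    (hl : elementLength ρ g ≤ 2) :
    (∃ s ∈ star ρ p, IsConj s g) ∨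
      ∃ s ∈ star ρ p, ∃ t ∈ star ρ p, s * t ≠ 1 ∧ IsConj (s * t) g := by
  obtain ⟨x, hx⟩ := axis_nonempty hT ρ g
  obtain ⟨h, rfl⟩ := htrans p x
  have hc : IsConj (h⁻¹ * g * h) g := isConj_iff.2 ⟨h, by group⟩
  have hd : T.dist p (ρ (h⁻¹ * g * h) p) = elementLength ρ g := by
    rw [mul_assoc, ← dist_apply_apply, mul_apply]
    exact hx
  have hpos := elementLength_pos hT hfree hg
  rcases (by omega : elementLength ρ g = 1 ∨ elementLength ρ g = 2) with e | e
  · exact Or.inl ⟨_, SimpleGraph.dist_eq_one_iff_adj.1 (hd.trans e), hc⟩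
  · obtain ⟨s, hs, t, ht, hst⟩ := exists_mul_of_dist_eq_two hT htrans (hd.trans e)
    refine Or.inr ⟨s, hs, t, ht, ?_, by rwa [← hst]⟩
    intro h1
    rw [hst, h1, one_apply, SimpleGraph.dist_self] at hd
    omega

/-- In an action with the length function of a rose, the axes of the petals have a common
vertex. -/
theorem exists_mem_axis_star {p : V} (hT' : T'.IsTree)
    (hfree' : IsFree ρ') (h1 : ∀ s ∈ star ρ p, elementLength ρ' s = 1)
    (h2 : ∀ s ∈ star ρ p, ∀ t ∈ star ρ p, s * t ≠ 1 → elementLength ρ' (s * t) = 2) :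
    ∃ p', ∀ s ∈ star ρ p, p' ∈ axis ρ' s := by
  have hmeet : ∀ s ∈ star ρ p, ∀ t ∈ star ρ p, t ≠ s⁻¹ → (axis ρ' s ∩ axis ρ' t).Nonempty := by
    intro s hs t ht hne
    rw [← Set.not_disjoint_iff_nonempty_inter, disjoint_axis_iff hT' hfree'
      (ne_one_of_mem_star hs) (ne_one_of_mem_star ht), h1 s hs, h1 t ht, h2 s hs t ht]
    · omega
    · exact fun h => hne (eq_inv_of_mul_eq_one_right h)
  -- If two axes of length-one elements share an edge, both elements, up to inversion, translate
  -- along that edge, so they agree up to inversion.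
  have huniq : ∀ s ∈ star ρ p, ∀ t ∈ star ρ p, t ≠ s → t ≠ s⁻¹ → ∀ x y, x ∈ axis ρ' s →
      x ∈ axis ρ' t → y ∈ axis ρ' s → y ∈ axis ρ' t → x = y := by
    intro s hs t ht hne hne' x y hxs hxt hys hyt
    by_contra hxy
    obtain ⟨w, hw, hwd⟩ := exists_adj_between hT' (Ne.symm hxy)
    have hxw := SimpleGraph.dist_eq_one_iff_adj.2 hw
    have hb : Between T' x w y := by unfold Between; omega
    have hws := axis_convex hT' ρ' s x hxs y hys w hb
    have hwt := axis_convex hT' ρ' t x hxt y hyt w hb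
    have e1 := eq_pow_apply_or hT' hfree' (ne_one_of_mem_star hs) hxs hws one_ne_zero
      (by rw [h1 s hs, hxw, mul_one])
    have e2 := eq_pow_apply_or hT' hfree' (ne_one_of_mem_star ht) hxt hwt one_ne_zero
      (by rw [h1 t ht, hxw, mul_one])
    rw [pow_one, pow_one] at e1 e2
    rcases e1 with e1 | e1 <;> rcases e2 with e2 | e2 <;> rw [e1] at e2 <;>
      have e3 := hfree'.eq_of_apply_eq e2
    · exact hne e3.symm
    · exact hne' (by rw [e3, inv_inv])
    · exact hne' e3.symm
    · exact hne (inv_injective e3).symm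
  by_cases hpair : ∃ s ∈ star ρ p, ∃ t ∈ star ρ p, t ≠ s ∧ t ≠ s⁻¹
  · obtain ⟨s, hs, t, ht, hne, hne'⟩ := hpair
    obtain ⟨p', hps, hpt⟩ := hmeet s hs t ht hne'
    refine ⟨p', fun r hr => ?_⟩
    by_cases e1 : r = s⁻¹
    · rwa [e1, axis_inv]
    by_cases e2 : r = t⁻¹
    · rwa [e2, axis_inv]
    obtain ⟨x, ⟨hxs, hxt⟩, hxr⟩ := (axis_convex hT' ρ' s).helly hT' (axis_convex hT' ρ' t)
      (axis_convex hT' ρ' r) ⟨p', hps, hpt⟩ (hmeet t ht r hr e2) (hmeet s hs r hr e1)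
    rwa [huniq s hs t ht hne hne' p' x hps hpt hxs hxt]
  -- The star is empty or consists of some `s` and its inverse.
  · push Not at hpair
    rcases (star ρ p).eq_empty_or_nonempty with he | ⟨s, hs⟩
    · obtain ⟨p'⟩ := hT'.connected.nonempty
      exact ⟨p', by simp [he]⟩
    · obtain ⟨p', hp'⟩ := axis_nonempty hT' ρ' s
      refine ⟨p', fun t ht => ?_⟩
      by_cases e : t = s
      · rwa [e]
      · rwa [hpair s hs t ht e, axis_inv]

theorem isDeterminedBy_of_transitive (hT : T.IsTree) (hfree : IsFree ρ)
    (htrans : ∀ x y : V, ∃ g, ρ g x = y) :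
    IsDeterminedBy.{u, v} ρ {c | c ≠ 1 ∧ translationLength ρ c ≤ 2} := by
  intro V' T' ρ' hT' hfree' hmin' hC
  obtain ⟨p⟩ := hT.connected.nonempty
  have hC' : ∀ g : Γ, g ≠ 1 → elementLength ρ g ≤ 2 → elementLength ρ' g = elementLength ρ g := by
    intro g hg hl
    refine hC (ConjClasses.mk g) ⟨?_, hl⟩
    rw [ConjClasses.one_eq_mk_one, Ne, ConjClasses.mk_eq_mk_iff_isConj, isConj_one_left]
    exact hg
  have h1 : ∀ s ∈ star ρ p, elementLength ρ' s = 1 := by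
    intro s hs
    have := elementLength_of_mem_star hT hfree hs
    rw [hC' s (ne_one_of_mem_star hs) (by omega), this]
  have h2 : ∀ s ∈ star ρ p, ∀ t ∈ star ρ p, s * t ≠ 1 → elementLength ρ' (s * t) = 2 := by
    intro s hs t ht hst
    have := elementLength_mul_of_mem_star hT hfree hs ht hst
    rw [hC' _ hst (by omega), this]
  obtain ⟨p', hp'⟩ := exists_mem_axis_star hT' hfree' h1 h2
  have hstar : ∀ s ∈ star ρ p, T'.dist p' (ρ' s p') = 1 := fun s hs => (hp' s hs).trans (h1 s hs)
  have hdist : ∀ k, T.dist p (ρ k p) ≤ 2 → T'.dist p' (ρ' k p') = T.dist p (ρ k p) := by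
    intro k hk
    rcases (by omega : T.dist p (ρ k p) = 0 ∨ T.dist p (ρ k p) = 1 ∨ T.dist p (ρ k p) = 2) with
      e | e | e
    · have : k = 1 := hfree.eq_of_apply_eq (x := p) (by
        rw [one_apply, ← (dist_eq_zero hT).1 e])
      subst this
      simp
    · rw [e]
      exact hstar k (SimpleGraph.dist_eq_one_iff_adj.1 e)
    · obtain ⟨s, hs, t, ht, rfl⟩ := exists_mul_of_dist_eq_two hT htrans e
      have hst : s * t ≠ 1 := by
        intro h
        rw [h, one_apply, SimpleGraph.dist_self] at e
        omega
      -- The length 2 of `st` bounds the displacement from below, the path through `s p'` from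
      -- above.
      have l1 := elementLength_le ρ' (s * t) p'
      rw [h2 s hs t ht hst] at l1
      have l2 := hT'.connected.dist_triangle (u := p') (v := ρ' s p') (w := ρ' (s * t) p')
      rw [hstar s hs, mul_apply, dist_iso, hstar t ht, ← mul_apply] at l2
      omega
  have hS : ∀ s ∈ insert 1 (star ρ p), T.dist p (ρ s p) ≤ 1 := by
    rintro s (rfl | hs)
    · simp
    · rw [dist_of_mem_star hs]
  refine equivariantlyIsomorphic_of_dist_eq hT hT' hmin' p p' (insert 1 (star ρ p)) ?_ ?_ ?_
  · intro x
    obtain ⟨a, rfl⟩ := htrans p x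
    exact ⟨a, 1, Set.mem_insert _ _, between_left _ _⟩
  · intro x y h
    obtain ⟨a, rfl⟩ := htrans p x
    obtain ⟨b, rfl⟩ := htrans p y
    refine ⟨a, a⁻¹ * b, Set.mem_insert_of_mem _ ?_, between_left _ _, ?_⟩
    · change T.Adj _ _
      rw [← SimpleGraph.dist_eq_one_iff_adj, ← dist_apply_apply]
      exact SimpleGraph.dist_eq_one_iff_adj.2 h
    · rw [mul_inv_cancel_left]
      exact between_right _ _
  · intro a c s hs t ht x hx1 hx2
    have d1 := hS s hs
    have d2 := hS t ht
    rw [← dist_iso (ρ a), ← mul_apply] at d1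
    rw [← dist_iso (ρ c), ← mul_apply] at d2
    unfold Between at hx1 hx2
    -- Ends of two meeting segments of length at most one are each within 1 of the common vertex,
    -- hence within 2 of each other.
    have key : ∀ g h : Γ, T.dist (ρ g p) x ≤ 1 → T.dist (ρ h p) x ≤ 1 →
        T'.dist (ρ' g p') (ρ' h p') = T.dist (ρ g p) (ρ h p) := by
      intro g h hg hh
      rw [dist_apply_apply, dist_apply_apply]
      apply hdist
      rw [← dist_apply_apply]
      have := hT.connected.dist_triangle (u := ρ g p) (v := x) (w := ρ h p)
      rw [T.dist_comm (u := x)] at this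
      omega
    rw [T.dist_comm (u := x)] at hx1 hx2
    exact ⟨key _ _ (by omega) (by omega), key _ _ (by omega) (by omega),
      key _ _ (by omega) (by omega), key _ _ (by omega) (by omega)⟩

end Star

/-! ### Counting the short conjugacy classes for a rose -/

section Count

variable {Γ : Type w} [Group Γ] {V : Type u} {T : SimpleGraph V} {ρ : Γ →* (T ≃g T)}

theorem transitive_of_isRose {n : ℕ} (h : IsRose (quotientGraph ρ) n) (x y : V) :
    ∃ g, ρ g x = y := by
  obtain ⟨z, hz⟩ := h.1
  have h1 : ∀ q : Quotient (vertexSetoid ρ), q = z := by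
    intro q
    have : q ∈ (quotientGraph ρ).vertexSet := Set.mem_univ q
    rwa [hz] at this
  exact Quotient.exact ((h1 (Quotient.mk _ x)).trans (h1 (Quotient.mk _ y)).symm)

theorem edgeSet_quotientGraph (ρ : Γ →* (T ≃g T)) : (quotientGraph ρ).edgeSet = Set.univ := by
  rw [Set.eq_univ_iff_forall]
  intro q
  induction q using Quotient.inductionOn with
  | _ e =>
    obtain ⟨e, he⟩ := e
    induction e with
    | _ x y => exact
      ((quotientGraph ρ).edge_mem_iff_exists_isLink _).2 ⟨_, _, x, y, he, rfl, rfl, rfl⟩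

theorem card_edges_of_isRose {n : ℕ} (h : IsRose (quotientGraph ρ) n) :
    ENat.card (Quotient (edgeSetoid ρ)) = n := by
  rw [← h.2, edgeSet_quotientGraph, Set.encard_univ]

/-- The edge orbit of the edge from `p` to its neighbour `ρ s p`. -/
def starEdge (ρ : Γ →* (T ≃g T)) (p : V) (s : star ρ p) : Quotient (edgeSetoid ρ) :=
  Quotient.mk (edgeSetoid ρ) ⟨s(p, ρ s p), s.2⟩

theorem starEdge_surjective (htrans : ∀ x y : V, ∃ g, ρ g x = y) (p : V) :
    Function.Surjective (starEdge ρ p) := by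
  intro q
  induction q using Quotient.inductionOn with
  | _ e =>
    obtain ⟨e, he⟩ := e
    induction e with
    | _ x y =>
      obtain ⟨g, rfl⟩ := htrans p x
      obtain ⟨h, rfl⟩ := htrans p y
      have hs : g⁻¹ * h ∈ star ρ p := by
        change T.Adj _ _
        rw [← SimpleGraph.dist_eq_one_iff_adj, ← dist_apply_apply]
        exact SimpleGraph.dist_eq_one_iff_adj.2 he
      refine ⟨⟨_, hs⟩, Quotient.sound ⟨g, ?_⟩⟩
      simp only [Sym2.map_mk, ← mul_apply, mul_inv_cancel_left]

theorem starEdge_eq_iff (hfree : IsFree ρ) {p : V} {s t : star ρ p} :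
    starEdge ρ p s = starEdge ρ p t ↔ (s : Γ) = t ∨ (s : Γ) = (t : Γ)⁻¹ := by
  constructor
  · intro h
    obtain ⟨g, hg⟩ := Quotient.exact h
    simp only [Sym2.map_mk, Sym2.eq_iff] at hg
    rcases hg with ⟨h1, h2⟩ | ⟨h1, h2⟩
    · have hg1 : g = 1 := hfree.eq_of_apply_eq (x := p) (by rw [h1, one_apply])
      rw [hg1, one_apply] at h2
      exact Or.inl (hfree.eq_of_apply_eq h2)
    · rw [hfree.eq_of_apply_eq h1, ← mul_apply] at h2
      right
      refine eq_inv_of_mul_eq_one_right (hfree.eq_of_apply_eq (x := p) ?_)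
      rw [h2, one_apply]
  · rintro (h | h)
    · rw [Subtype.ext h]
    · refine Quotient.sound ⟨t, ?_⟩
      simp only [Sym2.map_mk, ← mul_apply, h, mul_inv_cancel, one_apply]
      exact Sym2.eq_swap

/-- Choosing an orientation of each petal splits the star into chosen elements and their inverses.
The two halves are disjoint: an overlap would give a star element with `s * s = 1`, which would
invert an edge. -/
theorem exists_section (hfree : IsFree ρ) (htrans : ∀ x y : V, ∃ g, ρ g x = y) (p : V) :
    ∃ f : Quotient (edgeSetoid ρ) → star ρ p, Function.Injective f ∧
      (∀ s : star ρ p, ∃ q, s = f q ∨ (s : Γ) = (f q : Γ)⁻¹) ∧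
      ∀ q q', (f q : Γ) ≠ (f q' : Γ)⁻¹ := by
  obtain ⟨f, hf⟩ := (starEdge_surjective htrans p).hasRightInverse
  refine ⟨f, hf.injective, fun s => ⟨starEdge ρ p s, ?_⟩, fun q q' h => ?_⟩
  · rcases (starEdge_eq_iff hfree).1 (hf (starEdge ρ p s)).symm with h | h
    · exact Or.inl (Subtype.ext h)
    · exact Or.inr h
  · have h1 := (starEdge_eq_iff hfree).2 (Or.inr h)
    rw [hf, hf] at h1
    subst h1
    exact mul_self_ne_one_of_mem_star hfree (f q).2 (mul_eq_one_iff_eq_inv.2 h)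

/-- The conjugacy class of the product of two elements. -/
def classMul (S : Set Γ) : Sym2 S → ConjClasses Γ :=
  Sym2.lift ⟨fun s t => ConjClasses.mk ((s : Γ) * t), fun s t => by
    rw [ConjClasses.mk_eq_mk_iff_isConj]
    exact isConj_iff.2 ⟨(s : Γ)⁻¹, by group⟩⟩

theorem mk_eq_one_iff {g : Γ} : ConjClasses.mk g = 1 ↔ g = 1 := by
  rw [ConjClasses.one_eq_mk_one, ConjClasses.mk_eq_mk_iff_isConj, isConj_one_left]

theorem setOf_translationLength_le_two (hT : T.IsTree) (hfree : IsFree ρ)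
    (htrans : ∀ x y : V, ∃ g, ρ g x = y) (p : V) :
    {c | c ≠ 1 ∧ translationLength ρ c ≤ 2} =
      ConjClasses.mk '' star ρ p ∪
        classMul (star ρ p) '' {z | classMul (star ρ p) z ≠ 1} := by
  ext c
  constructor
  · induction c using Quotient.inductionOn with
    | _ g =>
      rintro ⟨h1, h2⟩
      rcases exists_conj_star hT hfree htrans p (fun h => h1 (mk_eq_one_iff.2 h)) h2 with
        ⟨s, hs, hc⟩ | ⟨s, hs, t, ht, hst, hc⟩
      · exact Or.inl ⟨s, hs, ConjClasses.mk_eq_mk_iff_isConj.2 hc⟩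
      · refine Or.inr ⟨s(⟨s, hs⟩, ⟨t, ht⟩), fun h => hst (mk_eq_one_iff.1 h),
          ConjClasses.mk_eq_mk_iff_isConj.2 hc⟩
  · rintro (⟨s, hs, rfl⟩ | ⟨z, hz, rfl⟩)
    · refine ⟨fun h => ne_one_of_mem_star hs (mk_eq_one_iff.1 h), ?_⟩
      rw [translationLength_mk, elementLength_of_mem_star hT hfree hs]
      exact one_le_two
    · refine ⟨hz, ?_⟩
      induction z with
      | _ s t =>
        exact (elementLength_mul_of_mem_star hT hfree s.2 t.2
          fun h => hz (mk_eq_one_iff.2 h)).le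

theorem encard_translationLength_le_two {n : ℕ} (hT : T.IsTree) (hfree : IsFree ρ)
    (hrose : IsRose (quotientGraph ρ) n) :
    {c | c ≠ 1 ∧ translationLength ρ c ≤ 2}.encard = ((2 * n ^ 2 + 2 * n : ℕ) : ℕ∞) := by
  classical
  have htrans := transitive_of_isRose hrose
  have hQ := card_edges_of_isRose hrose
  have hQfin : Finite (Quotient (edgeSetoid ρ)) := by
    rw [← ENat.card_lt_top, hQ]
    exact ENat.natCast_lt_top n
  have hQcard : Nat.card (Quotient (edgeSetoid ρ)) = n := by
    rw [ENat.card_eq_coe_natCard] at hQ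
    exact_mod_cast hQ
  obtain ⟨p⟩ := hT.connected.nonempty
  obtain ⟨f, hinj, hsurj, hne⟩ := exists_section hfree htrans p
  -- Each petal gives two star elements, one for each orientation.
  let F : Quotient (edgeSetoid ρ) ⊕ Quotient (edgeSetoid ρ) → star ρ p :=
    Sum.elim f fun q => ⟨(f q : Γ)⁻¹, inv_mem_star (f q).2⟩
  have hF : Function.Bijective F := by
    constructor
    · rintro (q | q) (q' | q') h
      · exact congrArg Sum.inl (hinj h)
      · exact absurd (congrArg Subtype.val h) (hne q q')
      · exact absurd (congrArg Subtype.val h).symm (hne q' q)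
      · exact congrArg Sum.inr (hinj (Subtype.ext (inv_injective (congrArg Subtype.val h))))
    · intro s
      obtain ⟨q, h | h⟩ := hsurj s
      · exact ⟨Sum.inl q, h.symm⟩
      · exact ⟨Sum.inr q, Subtype.ext h.symm⟩
  have hSfin : Finite (star ρ p) := Finite.of_surjective F hF.2
  have hScard : Nat.card (star ρ p) = 2 * n := by
    rw [← Nat.card_congr (Equiv.ofBijective F hF), Nat.card_sum, hQcard]
    omega
  have hone : {z | classMul (star ρ p) z ≠ 1}ᶜ =
      Set.range fun q => s(f q, ⟨(f q : Γ)⁻¹, inv_mem_star (f q).2⟩) := by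
    ext z
    rw [Set.mem_compl_iff, Set.mem_ofPred_eq, not_not]
    constructor
    · induction z with
      | _ s t =>
        intro h
        have h1 : (s : Γ) * t = 1 := mk_eq_one_iff.1 h
        have h2 : (t : Γ) = (s : Γ)⁻¹ := eq_inv_of_mul_eq_one_right h1
        obtain ⟨q, e | e⟩ := hsurj s
        · refine ⟨q, ?_⟩
          rw [Sym2.eq_iff]
          exact Or.inl ⟨e.symm, Subtype.ext (by rw [h2, e])⟩
        · refine ⟨q, ?_⟩
          rw [Sym2.eq_iff]
          exact Or.inr ⟨Subtype.ext (by rw [h2, e, inv_inv]), Subtype.ext e.symm⟩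
    · rintro ⟨q, rfl⟩
      exact mk_eq_one_iff.2 (mul_inv_cancel _)
  have honecard : ({z | classMul (star ρ p) z ≠ 1}ᶜ).ncard = n := by
    rw [hone, ← Set.image_univ, Set.ncard_image_of_injective, Set.ncard_univ, hQcard]
    intro q q' h
    rcases Sym2.eq_iff.1 h with h | h
    · exact hinj h.1
    · exact absurd (congrArg Subtype.val h.1) (hne q q')
  -- Unordered pairs, with repetition allowed, from `2n` elements number `(2n + 1).choose 2`.
  -- Removing the `n` pairs of mutually inverse elements leaves `2n²` classes of length 2.
  have hsym : Nat.card (Sym2 (star ρ p)) = 2 * n ^ 2 + n := by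
    have := Fintype.ofFinite (star ρ p)
    rw [Nat.card_eq_fintype_card, Sym2.card, ← Nat.card_eq_fintype_card, hScard,
      Nat.choose_two_right, Nat.add_sub_cancel]
    refine Nat.div_eq_of_eq_mul_left two_pos ?_
    ring
  have hcount : {z | classMul (star ρ p) z ≠ 1}.ncard = 2 * n ^ 2 := by
    have := Set.ncard_add_ncard_compl {z | classMul (star ρ p) z ≠ 1}
    omega
  have hinj1 : Set.InjOn ConjClasses.mk (star ρ p) := fun s hs t ht h =>
    eq_of_isConj_of_mem_star hT hfree hs ht (ConjClasses.mk_eq_mk_iff_isConj.1 h)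
  have hinj2 : Set.InjOn (classMul (star ρ p)) {z | classMul (star ρ p) z ≠ 1} := by
    intro z hz z' hz' h
    induction z with
    | _ s t =>
      induction z' with
      | _ s' t' =>
        rw [Sym2.eq_iff]
        rcases eq_or_eq_swap_of_isConj hT hfree s.2 t.2 s'.2 t'.2
          (fun e => hz (mk_eq_one_iff.2 e)) (fun e => hz' (mk_eq_one_iff.2 e))
          (ConjClasses.mk_eq_mk_iff_isConj.1 h) with e | e
        · exact Or.inl ⟨Subtype.ext e.1, Subtype.ext e.2⟩
        · exact Or.inr ⟨Subtype.ext e.1, Subtype.ext e.2⟩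
  have hdisj : Disjoint (ConjClasses.mk '' star ρ p)
      (classMul (star ρ p) '' {z | classMul (star ρ p) z ≠ 1}) := by
    rw [Set.disjoint_left]
    rintro _ ⟨s, hs, rfl⟩ ⟨z, hz, h⟩
    induction z with
    | _ a b =>
      have h1 := elementLength_mul_of_mem_star hT hfree a.2 b.2
        fun e => hz (mk_eq_one_iff.2 e)
      have h2 := congrArg (translationLength ρ) h
      rw [translationLength_mk, elementLength_of_mem_star hT hfree hs] at h2
      exact absurd (h1.symm.trans h2) (by decide)
  have hstarfin : (star ρ p).Finite := Set.toFinite _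
  rw [setOf_translationLength_le_two hT hfree htrans p, Set.encard_union_eq hdisj,
    hinj1.encard_image, hinj2.encard_image, ← Set.Finite.cast_ncard_eq hstarfin,
    ← Set.Finite.cast_ncard_eq (Set.toFinite {z | classMul (star ρ p) z ≠ 1}), hcount,
    ← Nat.card_coe_set_eq, hScard]
  norm_cast
  omega

end Count

end TreeAction

theorem mainTheorem5 (n : ℕ) {V : Type u} (T : SimpleGraph V) (hT : T.IsTree)
    (ρ : FreeGroup (Fin n) →* (T ≃g T))
    (hfree : TreeAction.IsFree ρ) (hmin : TreeAction.IsMinimal ρ) :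
    (∃ C : Set (ConjClasses (FreeGroup (Fin n))),
      C.Finite ∧ TreeAction.IsDeterminedBy.{u, v} ρ C) ∧
    (TreeAction.IsRose (TreeAction.quotientGraph ρ) n →
      {c : ConjClasses (FreeGroup (Fin n)) |
        c ≠ 1 ∧ TreeAction.translationLength ρ c ≤ 2}.encard = ((2 * n ^ 2 + 2 * n : ℕ) : ℕ∞) ∧
      TreeAction.IsDeterminedBy.{u, v} ρ
        {c : ConjClasses (FreeGroup (Fin n)) |
          c ≠ 1 ∧ TreeAction.translationLength ρ c ≤ 2}) :=
  ⟨TreeAction.exists_finite_isDeterminedBy n hT hfree hmin, fun h =>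
    ⟨TreeAction.encard_translationLength_le_two hT hfree h,
      TreeAction.isDeterminedBy_of_transitive hT hfree (TreeAction.transitive_of_isRose h)⟩⟩
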